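/- For $n\ge 2$ and real numbers $c_0,\dots,c_{n-1}$ let $f(\lambda)=\lambda_1\cdots\lambda_n-\sum_{k=0}^{n-1}c_k\sigma_k(\lambda)$ on $\mathbb{R}^n$, where $\sigma_k$ is the $k$-th elementary symmetric polynomial ($\sigma_0=1$). Let $\Gamma_n=\{\lambda\in\mathbb{R}^n:\lambda_i>0\text{ for all }i\}$ be the positive orthant. By the level set of the equation $f=0$ we mean the connected component of $\{f=0\}$ that is contained in $q+\Gamma_n$ for some $q\in\mathbb{R}^n$. We say that the equation $f=0$ has convex level set if there is exactly one such component $L$, and $L$ is the boundary of a connected component of $\{f>0\}$ which is convex and is contained in $q+\Gamma_n$ for some $q\in\mathbb{R}^n$. Proposition 4.1. The following equations have convex level set. (1) $\lambda_1\lambda_2-c_0=0$, where $c_0>0$. (2) $\lambda_1\lambda_2\lambda_3-c_1(\lambda_1+\lambda_2+\lambda_3)-c_0=0$, where $c_1\ge 0$ and $c_0>-2c_1^{3/2}$. (3) $\lambda_1\lambda_2\lambda_3\lambda_4-c_2\sigma_2(\lambda)-c_1\sigma_1(\lambda)-c_0=0$, where $c_2\ge 0$, $c_1\ge -2c_2^{3/2}$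 and $c_0>-3c_2x_1^2-3c_1x_1$. Here $$x_1=\begin{cases}\sqrt[3]{c_1}, & c_2=0,\\ 2\sqrt{c_2}\,\cos\Bigl[\tfrac13\arccos\Bigl(\tfrac{c_1}{2c_2^{3/2}}\Bigr)\Bigr], & c_2>0,\ 4c_2^3-c_1^2\ge 0,\\ 2\sqrt{c_2}\,\cosh\Bigl[\tfrac13\operatorname{arccosh}\Bigl(\tfrac{c_1}{2c_2^{3/2}}\Bigr)\Bigr], & c_1,c_2>0,\ 4c_2^3-c_1^2\le 0,\end{cases}$$ with $\arccos$ valued in $[0,\pi]$ and $\operatorname{arccosh}\ge 0$. Moreover, whenever $c_2\ge 0$ and $c_1\ge -2c_2^{3/2}$, $x_1$ is the largest real root of $x^3-3c_2x-c_1$. -/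

import Mathlib

/-- The `k`-th elementary symmetric polynomial `σ_k(l₁, …, lₙ)`, with `σ_0 = 1`. -/
noncomputable def sigmaSymm {n : ℕ} (k : ℕ) (l : Fin n → ℝ) : ℝ :=
  MvPolynomial.eval l (MvPolynomial.esymm (Fin n) ℝ k)

/-- The general inverse `σ_k` type multilinear polynomial
`f(l) = l₁ ⋯ lₙ - ∑_{k = 0}^{n - 1} c_k σ_k(l)` with coefficients `c = (c_0, …, c_{n-1})`. -/
noncomputable def invSigma {n : ℕ} (c : Fin n → ℝ) (l : Fin n → ℝ) : ℝ :=
  (∏ i, l i) - ∑ k : Fin n, c k * sigmaSymm (k : ℕ) l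

/-- The translate `q + Γₙ` of the positive orthant `Γₙ = {l : l_i > 0 for all i}`. -/
def translatedOrthant {n : ℕ} (q : Fin n → ℝ) : Set (Fin n → ℝ) :=
  {l | ∀ i, q i < l i}

/-- `C` is a connected component of the set `S`. -/
def IsConnectedComponentOf {X : Type*} [TopologicalSpace X] (C S : Set X) : Prop :=
  ∃ x ∈ S, C = connectedComponentIn S x

/-- `L` is a level set of the equation `f = 0`: the zero set `{f = 0}` is in general
disconnected, and what is meant is a connected component of it that is contained in
`q + Γₙ` for some `q`. -/
def IsLevelSetOf {n : ℕ} (f : (Fin n → ℝ) → ℝ) (L : Set (Fin n → ℝ)) : Prop :=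
  IsConnectedComponentOf L {l | f l = 0} ∧ ∃ q, L ⊆ translatedOrthant q

/-- The hypersurface `L ⊆ {f = 0}` is convex: it is the whole boundary of its enclosed region,
a connected component of `{f > 0}` contained in `q + Γₙ` for some `q`,
and this region is a convex set. -/
def IsConvexLevelSet {n : ℕ} (f : (Fin n → ℝ) → ℝ) (L : Set (Fin n → ℝ)) : Prop :=
  ∃ G : Set (Fin n → ℝ), IsConnectedComponentOf G {l | 0 < f l} ∧
    (∃ q, G ⊆ translatedOrthant q) ∧ frontier G = L ∧ Convex ℝ G

/-- The level set of the equation `f = 0` is well defined (it exists and is unique),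
and it is convex. -/
def HasConvexLevelSet {n : ℕ} (f : (Fin n → ℝ) → ℝ) : Prop :=
  (∃! L, IsLevelSetOf f L) ∧ ∀ L, IsLevelSetOf f L → IsConvexLevelSet f L

/-- The trigonometric / hyperbolic expression for the largest real root of
`x³ - 3 c₂ x - c₁`. It is used for `c₂ ≥ 0` and `c₁ ≥ -2 c₂^{3/2}` only: then `c₁ ≥ 0` in the
first branch, and `c₁ > 0`, `c₂ > 0` in the third one. In the common boundary case
`c₁ = 2 c₂^{3/2}` of the last two branches both formulas give `2 √c₂`. -/
noncomputable def cubicRoot (c₁ c₂ : ℝ) : ℝ :=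
  if c₂ = 0 then c₁ ^ (1 / 3 : ℝ)
  else if 0 ≤ 4 * c₂ ^ 3 - c₁ ^ 2 then
    2 * √c₂ * Real.cos (1 / 3 * Real.arccos (c₁ / (2 * c₂ ^ (3 / 2 : ℝ))))
  else
    2 * √c₂ * Real.cosh (1 / 3 * Real.arcosh (c₁ / (2 * c₂ ^ (3 / 2 : ℝ))))

/-! Restricted to the plane of two coordinates, each of these polynomials is `A x y + B (x + y) +
C`. On a component of `{f = 0}` that is bounded from below, `A = 0` would allow a slide to `-∞`.
Hence the plane section is a hyperbola, and the point lies on its upper branch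
(`IsLevelSetOf.upper_branch`). This fixes the signs of the derivatives and places every level set in
the region `P` where all nonconstant partial derivatives of `f` are positive. Minimising the sum of
the coordinates produces a diagonal point; since `f` increases along the diagonal in `P`, there is
only one such component.

The lower bound on `c₀` makes `f` negative on the boundary of `P`, so components of `{f = 0}` and
`{f > 0}` that meet `P` stay in it. By `hasConvexLevelSet_of_region` only convexity of `P ∩ {f > 0}`
remains.

In degree two this is concavity of the geometric mean, in degree three convexity of a rational graph
(`graph_convex`). In degree four, with `g = √c₂`, two coordinates at a time are moved to the vertex
of their hyperbola. Convexity passes back from the vertices (`invSigma_four_combo_pos`), so points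
`(w, w, z, z)` suffice. With `m = (w + z) / 2` and `d = (w - z) / 2`, positivity there reads `d² <
m² - g² - √Q(m)` with `Q` quadratic. If `Q` has positive discriminant, the square root of the right
side is concave (`sqrt_sub_sqrt_concaveOn`); otherwise `√Q` is convex, and monotonicity of `f`
covers what is left. -/

open Function in
/-- In the coordinates `i` and `j`, around the point `l`, the function `f` is the symmetric
multiaffine polynomial `A x y + B (x + y) + C`. -/
def PairForm {n : ℕ} (f : (Fin n → ℝ) → ℝ) (i j : Fin n) (l : Fin n → ℝ) (A B C : ℝ) : Prop :=
  ∀ x y, f (update (update l i x) j y) = A * (x * y) + B * (x + y) + C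

/-! ### Zero-set components bounded from below, and the region criterion. -/

section LevelSets

open Function

variable {n : ℕ} {f : (Fin n → ℝ) → ℝ} {L : Set (Fin n → ℝ)}

theorem IsConnectedComponentOf.mem_of_path {X : Type*} [TopologicalSpace X] {C S : Set X}
    (hC : IsConnectedComponentOf C S) {T : Set ℝ} (hT : IsPreconnected T) {γ : ℝ → X}
    (hγ : ContinuousOn γ T) (hS : ∀ t ∈ T, γ t ∈ S) {t₀ : ℝ} (h₀ : t₀ ∈ T) (hC₀ : γ t₀ ∈ C) :
    ∀ t ∈ T, γ t ∈ C := by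
  obtain ⟨x, -, rfl⟩ := hC
  rw [connectedComponentIn_eq hC₀]
  intro t ht
  exact (hT.image γ hγ).subset_connectedComponentIn (Set.mem_image_of_mem γ h₀)
    (by rintro _ ⟨s, hs, rfl⟩; exact hS s hs) (Set.mem_image_of_mem γ ht)

theorem IsConnectedComponentOf.isClosed {X : Type*} [TopologicalSpace X] {C S : Set X}
    (hC : IsConnectedComponentOf C S) (hS : IsClosed S) : IsClosed C := by
  obtain ⟨x, hx, rfl⟩ := hC
  refine isClosed_of_closure_subset ?_
  exact isPreconnected_connectedComponentIn.closure.subset_connectedComponentIn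
    (subset_closure (mem_connectedComponentIn hx))
    (closure_minimal (connectedComponentIn_subset _ _) hS)

theorem continuousOn_update_update {T : Set ℝ} (i j : Fin n) (l : Fin n → ℝ) {g h : ℝ → ℝ}
    (hg : ContinuousOn g T) (hh : ContinuousOn h T) :
    ContinuousOn (fun t => update (update l i (g t)) j (h t)) T := fun t ht =>
  ((continuousWithinAt_const (b := l)).update i (hg t ht)).update j (hh t ht)

theorem PairForm.swap {i j : Fin n} (hij : i ≠ j) {l : Fin n → ℝ} {A B C : ℝ}
    (h : PairForm f i j l A B C) : PairForm f j i l A B C := by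
  intro x y
  rw [update_comm hij.symm, h]; ring

theorem PairForm.eval_self {i j : Fin n} {l : Fin n → ℝ} {A B C : ℝ}
    (h : PairForm f i j l A B C) : f l = A * (l i * l j) + B * (l i + l j) + C := by
  have := h (l i) (l j)
  simpa using this

/-- A curve in the plane of the coordinates `i`, `j` along which the pair form is constant stays in
the connected component. -/
theorem IsLevelSetOf.mem_of_pairForm (hL : IsLevelSetOf f L) {i j : Fin n}
    {l : Fin n → ℝ} (hl : l ∈ L) {A B C : ℝ} (h : PairForm f i j l A B C) {T : Set ℝ}
    (hT : IsPreconnected T) {x y : ℝ → ℝ} (hx : ContinuousOn x T) (hy : ContinuousOn y T)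
    (hxy : ∀ t ∈ T, A * (x t * y t) + B * (x t + y t) = A * (l i * l j) + B * (l i + l j))
    {t₀ : ℝ} (h₀ : t₀ ∈ T) (hx₀ : x t₀ = l i) (hy₀ : y t₀ = l j) :
    ∀ t ∈ T, update (update l i (x t)) j (y t) ∈ L := by
  refine hL.1.mem_of_path hT (continuousOn_update_update i j l hx hy) ?_ h₀ ?_
  · intro t ht
    have h0 : f l = 0 := by
      obtain ⟨⟨z, -, rfl⟩, -⟩ := hL
      exact connectedComponentIn_subset {l | f l = 0} z hl
    change f _ = 0
    rw [h, hxy t ht, ← h.eval_self, h0]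
  · simpa [hx₀, hy₀] using hl

theorem IsLevelSetOf.hyperbola_mem (hL : IsLevelSetOf f L) {i j : Fin n}
    {l : Fin n → ℝ} (hl : l ∈ L) {A B C : ℝ} (h : PairForm f i j l A B C) (hA : A ≠ 0)
    {s : ℝ} (hs : 0 < s) :
    update (update l i (-B / A + (l i + B / A) * s)) j (-B / A + (l j + B / A) / s) ∈ L := by
  refine hL.mem_of_pairForm hl h (T := Set.Ioi 0) isPreconnected_Ioi
    (x := fun s => -B / A + (l i + B / A) * s) (y := fun s => -B / A + (l j + B / A) / s)
    (by fun_prop) ?_ ?_ (t₀ := 1) (by simp) (by ring) (by ring) s hs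
  · exact continuousOn_const.add (continuousOn_const.div continuousOn_id fun t ht => ne_of_gt ht)
  · intro t ht
    have : t ≠ 0 := ne_of_gt ht
    field_simp
    ring

theorem IsLevelSetOf.bddBelow_coord (hL : IsLevelSetOf f L) (i : Fin n) :
    ∃ q, ∀ l ∈ L, q < l i := by
  obtain ⟨q, hq⟩ := hL.2
  exact ⟨q i, fun l hl => hq hl i⟩

/-- On a level set bounded from below every pair form is nondegenerate. -/
theorem IsLevelSetOf.leading_ne_zero (hL : IsLevelSetOf f L) {i j : Fin n}
    {l : Fin n → ℝ} (hl : l ∈ L) {A B C : ℝ} (h : PairForm f i j l A B C) : A ≠ 0 := by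
  rintro rfl
  obtain ⟨q, hq⟩ := hL.bddBelow_coord j
  -- With `A = 0` only the sum of the two coordinates matters; at time `l j - q` coordinate `j` has
  -- dropped to its strict lower bound `q`.
  have := hL.mem_of_pairForm hl h (T := Set.univ) isPreconnected_univ
    (x := fun s => l i + s) (y := fun s => l j - s) (by fun_prop) (by fun_prop)
    (by intro t _; ring) (t₀ := 0) trivial (by simp) (by simp) (l j - q) trivial
  have := hq _ this
  simp at this

/-- On a level set bounded from below every point lies on the upper branch of the hyperbola cut
out by the plane of two coordinates. -/
theorem IsLevelSetOf.upper_branch (hL : IsLevelSetOf f L) {i j : Fin n} (hij : i ≠ j)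
    {l : Fin n → ℝ} (hl : l ∈ L) {A B C : ℝ} (h : PairForm f i j l A B C) :
    0 < l i + B / A := by
  have hA := hL.leading_ne_zero hl h
  rcases lt_trichotomy (l i + B / A) 0 with hX | hX | hX
  · obtain ⟨q, hq⟩ := hL.bddBelow_coord i
    -- On the lower branch, scaling by this `s` pushes coordinate `i` down to `q` or below; the
    -- maximum with `1` keeps `s` positive.
    obtain ⟨s, hs⟩ : ∃ s, s = max 1 ((q + B / A) / (l i + B / A)) := ⟨_, rfl⟩
    have hs0 : 0 < s := by rw [hs]; positivity
    have h1 := hq _ (hL.hyperbola_mem hl h hA hs0)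
    rw [update_of_ne hij, update_self] at h1
    have h2 : (q + B / A) / (l i + B / A) ≤ s := by rw [hs]; exact le_max_right _ _
    rw [div_le_iff_of_neg hX] at h2
    have : -B / A = -(B / A) := by ring
    rw [this] at h1
    linarith
  · exfalso
    obtain ⟨q, hq⟩ := hL.bddBelow_coord j
    have hB : B = -(A * l i) := by field_simp at hX; linarith
    have := hL.mem_of_pairForm hl h (T := Set.univ) isPreconnected_univ
      (x := fun _ => l i) (y := fun s => l j - s) (by fun_prop) (by fun_prop)
      (by intro t _; rw [hB]; ring) (t₀ := 0) trivial (by simp) (by simp) (l j - q) trivial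
    have := hq _ this
    simp at this
  · exact hX

/-- A sign form of `IsLevelSetOf.upper_branch`: the partial derivative with respect to `j` and the
mixed second derivative have the same sign. -/
theorem IsLevelSetOf.mul_pos (hL : IsLevelSetOf f L) {i j : Fin n} (hij : i ≠ j)
    {l : Fin n → ℝ} (hl : l ∈ L) {A B C : ℝ} (h : PairForm f i j l A B C) :
    0 < A * (A * l i + B) := by
  have hA := hL.leading_ne_zero hl h
  have h1 : A * (A * l i + B) = A ^ 2 * (l i + B / A) := by field_simp
  rw [h1]
  exact _root_.mul_pos (by positivity) (hL.upper_branch hij hl h)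

/-- The level set contains points with arbitrarily large `i`-th coordinate, moving only the
coordinates `i` and `j`. -/
theorem IsLevelSetOf.exists_large (hL : IsLevelSetOf f L) {i j : Fin n} (hij : i ≠ j)
    {l : Fin n → ℝ} (hl : l ∈ L) {A B C : ℝ} (h : PairForm f i j l A B C) (M : ℝ) :
    ∃ x y, M < x ∧ update (update l i x) j y ∈ L := by
  have hA := hL.leading_ne_zero hl h
  have hX := hL.upper_branch hij hl h
  obtain ⟨s, hs⟩ : ∃ s, s = max 1 ((M + 1 + B / A) / (l i + B / A)) := ⟨_, rfl⟩
  have hs0 : 0 < s := by rw [hs]; positivity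
  refine ⟨_, _, ?_, hL.hyperbola_mem hl h hA hs0⟩
  have h2 : (M + 1 + B / A) / (l i + B / A) ≤ s := by rw [hs]; exact le_max_right _ _
  rw [div_le_iff₀ hX] at h2
  have : -B / A = -(B / A) := by ring
  rw [this]
  linarith

/-- A level set bounded from below meets the diagonal: the sum of the coordinates has a minimum
on it, which is attained there. -/
theorem IsLevelSetOf.exists_diagonal [NeZero n] (hf : Continuous f) (hL : IsLevelSetOf f L)
    (hpair : ∀ i j, i ≠ j → ∀ l, ∃ A B C, PairForm f i j l A B C) :
    ∃ t : ℝ, (fun _ => t) ∈ L := by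
  have hclosed : IsClosed L := hL.1.isClosed (isClosed_eq hf continuous_const)
  obtain ⟨z, hz⟩ : L.Nonempty := by
    obtain ⟨⟨z, hz, rfl⟩, -⟩ := hL
    exact ⟨z, mem_connectedComponentIn hz⟩
  obtain ⟨q, hq⟩ := hL.2
  have hcont : Continuous fun l : Fin n → ℝ => ∑ i, l i := by fun_prop
  have hcompact : IsCompact (L ∩ {l | ∑ i, l i ≤ ∑ i, z i}) := by
    refine IsCompact.of_isClosed_subset
      (isCompact_Icc (a := q) (b := fun i => q i + (∑ i, z i - ∑ i, q i)))
      (hclosed.inter (isClosed_le hcont continuous_const)) ?_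
    rintro l ⟨hl, hle⟩
    refine ⟨fun i => (hq hl i).le, fun i => ?_⟩
    have h1 : l i - q i ≤ ∑ i, (l i - q i) :=
      Finset.single_le_sum (f := fun i => l i - q i) (fun k _ => sub_nonneg.2 (hq hl k).le)
        (Finset.mem_univ i)
    rw [Finset.sum_sub_distrib] at h1
    have h2 : ∑ i, l i ≤ ∑ i, z i := hle
    dsimp only
    linarith
  obtain ⟨m, ⟨hm, hmz⟩, hmin⟩ := hcompact.exists_isMinOn ⟨z, hz, le_refl (∑ i, z i)⟩ hcont.continuousOn
  have hmin' : ∀ l ∈ L, ∑ i, m i ≤ ∑ i, l i := by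
    intro l hl
    by_cases hle : ∑ i, l i ≤ ∑ i, z i
    · exact hmin ⟨hl, hle⟩
    · exact le_trans hmz (not_le.1 hle).le
  have heq : ∀ i j, i ≠ j → m i = m j := by
    intro i j hij
    obtain ⟨A, B, C, h⟩ := hpair i j hij m
    have hA := hL.leading_ne_zero hm h
    have hX := hL.upper_branch hij hm h
    have hY := hL.upper_branch hij.symm hm (h.swap hij)
    set X := m i + B / A with hXdef
    set Y := m j + B / A with hYdef
    have hsX := Real.sqrt_pos.2 hX
    have hsY := Real.sqrt_pos.2 hY
    have hXX := Real.mul_self_sqrt hX.le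
    have hYY := Real.mul_self_sqrt hY.le
    -- The parameter `√Y / √X` leads to the vertex of the hyperbola, replacing `X + Y` by `2 √X √Y`
    -- in the sum. Minimality then forces `(√X - √Y)² ≤ 0`.
    have hmem := hmin' _ (hL.hyperbola_mem hm h hA (div_pos hsY hsX))
    have e1 : -B / A + (m i + B / A) * (√Y / √X) = -B / A + √X * √Y := by
      rw [← hXdef]
      nth_rewrite 1 [← hXX]
      field_simp
    have e2 : -B / A + (m j + B / A) / (√Y / √X) = -B / A + √X * √Y := by
      rw [← hYdef]
      nth_rewrite 1 [← hYY]
      field_simp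
    rw [e1, e2, Finset.sum_update_of_mem (Finset.mem_univ _),
      ← Finset.sum_erase_add Finset.univ m (Finset.mem_univ j),
      ← Finset.erase_eq, ← Finset.sum_erase_add (Finset.univ.erase j) m (a := i) (by simp [hij]),
      Finset.sum_update_of_mem (by simp [hij]), ← Finset.erase_eq] at hmem
    have e3 : -B / A = -(B / A) := by ring
    have h0 : (√X - √Y) ^ 2 ≤ 0 := by
      rw [e3] at hmem
      nlinarith
    have h1 : √X = √Y := by
      have := pow_eq_zero_iff (two_ne_zero) |>.1 (le_antisymm h0 (sq_nonneg _))
      linarith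
    have h2 : X = Y := by rw [← hXX, ← hYY, h1]
    linarith
  refine ⟨m 0, ?_⟩
  convert hm using 1
  funext i
  by_cases hi : i = 0
  · rw [hi]
  · exact heq 0 i (Ne.symm hi)

/-- A criterion for a convex level set: the polynomial has symmetric pair forms, and `P` is an open
region that is closed relative to `{0 ≤ f}`, on which `f` increases along the diagonal, which holds
all level sets, and in which `{0 < f}` is convex. -/
theorem hasConvexLevelSet_of_region [NeZero n] (hf : Continuous f)
    (hpair : ∀ i j, i ≠ j → ∀ l, ∃ A B C, PairForm f i j l A B C)
    {P : Set (Fin n → ℝ)} (hP : IsOpen P) (hcl : ∀ l ∈ closure P, 0 ≤ f l → l ∈ P)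
    (hbdd : ∀ l ∈ P, ∀ i, 0 < l i) (hL : ∀ L, IsLevelSetOf f L → L ⊆ P)
    (hmono : ∀ l ∈ P, ∀ s > 0, f l < f (fun i => l i + s))
    (hdiag : ∃ t : ℝ, (fun _ => t) ∈ P ∧ f (fun _ => t) = 0)
    (hconv : Convex ℝ (P ∩ {l | 0 < f l})) :
    HasConvexLevelSet f := by
  -- `P` is both open and closed relative to `{0 ≤ f}`, so a connected subset of `{0 ≤ f}` cannot
  -- leave it.
  have hsub : ∀ S : Set (Fin n → ℝ), IsPreconnected S → (∀ l ∈ S, 0 ≤ f l) → (S ∩ P).Nonempty →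
      S ⊆ P := fun S hS h0 hne =>
    hS.subset_of_closure_inter_subset hP hne fun l hl => hcl l hl.1 (h0 l hl.2)
  have hPq : P ⊆ translatedOrthant 0 := fun l hl i => hbdd l hl i
  have hlevel : ∀ l ∈ P, f l = 0 → IsLevelSetOf f (connectedComponentIn {l | f l = 0} l) := by
    intro l hl h0
    refine ⟨⟨l, h0, rfl⟩, 0, subset_trans (hsub _ isPreconnected_connectedComponentIn ?_ ?_) hPq⟩
    · intro k hk
      exact (connectedComponentIn_subset {l | f l = 0} l hk).ge
    · exact ⟨l, mem_connectedComponentIn h0, hl⟩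
  have hzero : ∀ L, IsLevelSetOf f L → ∀ l ∈ L, f l = 0 := by
    rintro L ⟨⟨z, -, rfl⟩, -⟩ l hl
    exact connectedComponentIn_subset {l | f l = 0} z hl
  -- Both components contain a diagonal zero in `P`; strict growth along the diagonal makes these
  -- points equal.
  have huniq : ∀ L L', IsLevelSetOf f L → IsLevelSetOf f L' → L = L' := by
    intro L L' h h'
    obtain ⟨t, ht⟩ := h.exists_diagonal hf hpair
    obtain ⟨t', ht'⟩ := h'.exists_diagonal hf hpair
    have key : ∀ a b : ℝ, (fun _ => a) ∈ P → f (fun _ => a) = 0 → f (fun _ => b) = 0 → ¬ a < b := by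
      intro a b ha ha0 hb0 hab
      have := hmono _ ha (b - a) (sub_pos.2 hab)
      simp only [add_sub_cancel] at this
      linarith
    have htt : t = t' := le_antisymm
      (not_lt.1 (key t' t (hL _ h' ht') (hzero _ h' _ ht') (hzero _ h _ ht)))
      (not_lt.1 (key t t' (hL _ h ht) (hzero _ h _ ht) (hzero _ h' _ ht')))
    subst htt
    obtain ⟨⟨z, -, rfl⟩, -⟩ := h
    obtain ⟨⟨z', -, rfl⟩, -⟩ := h'
    rw [connectedComponentIn_eq ht, connectedComponentIn_eq ht']
  obtain ⟨t, htP, ht0⟩ := hdiag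
  refine ⟨⟨_, hlevel _ htP ht0, fun L h => huniq _ _ h (hlevel _ htP ht0)⟩, fun L h => ?_⟩
  have hopen : IsOpen (P ∩ {l | 0 < f l}) := hP.inter (isOpen_lt continuous_const hf)
  have hup : ∀ l ∈ P, f l = 0 → l ∈ closure (P ∩ {l | 0 < f l}) := by
    intro l hl h0
    have hc : Continuous fun s : ℝ => (fun i => l i + s : Fin n → ℝ) := by fun_prop
    have htend : Filter.Tendsto (fun s : ℝ => (fun i => l i + s : Fin n → ℝ))
        (nhdsWithin 0 (Set.Ioi 0)) (nhds l) := by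
      have := (hc.tendsto 0).mono_left (nhdsWithin_le_nhds (s := Set.Ioi 0))
      simpa using this
    refine mem_closure_of_tendsto htend ?_
    filter_upwards [htend.eventually_mem (hP.mem_nhds hl), self_mem_nhdsWithin] with s hs hs0
    exact ⟨hs, by simpa [h0] using hmono l hl s hs0⟩
  have hne : (P ∩ {l | 0 < f l}).Nonempty :=
    closure_nonempty_iff.1 ⟨_, hup _ htP ht0⟩
  obtain ⟨g, hgP, hg⟩ := hne
  refine ⟨P ∩ {l | 0 < f l}, ⟨g, hg, ?_⟩, ⟨0, fun l hl => hPq hl.1⟩, ?_, hconv⟩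
  · refine subset_antisymm
      (hconv.isPreconnected.subset_connectedComponentIn ⟨hgP, hg⟩ Set.inter_subset_right) ?_
    refine Set.subset_inter (hsub _ isPreconnected_connectedComponentIn ?_ ?_)
      (connectedComponentIn_subset _ _)
    · intro k hk
      exact (connectedComponentIn_subset {l | 0 < f l} g hk).le
    · exact ⟨g, mem_connectedComponentIn hg, hgP⟩
  · rw [hopen.frontier_eq]
    ext l
    constructor
    · rintro ⟨hl, hl'⟩
      have h0 : 0 ≤ f l := closure_minimal (fun k hk => (hk.2 : 0 < f k).le)
        (isClosed_le continuous_const hf) hl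
      have hlP := hcl l (closure_mono Set.inter_subset_left hl) h0
      have h0' : f l = 0 := le_antisymm (not_lt.1 fun hlt => hl' ⟨hlP, hlt⟩) h0
      rw [huniq _ _ h (hlevel l hlP h0')]
      exact mem_connectedComponentIn h0'
    · intro hl
      have h0 := hzero _ h _ hl
      exact ⟨hup l (hL _ h hl) h0, fun hlt => (hlt.2 : 0 < f l).ne' h0⟩

end LevelSets

/-! ### Cauchy–Schwarz type inequalities and convexity of a rational graph. -/

section Inequalities

/-- Cauchy–Schwarz for `(√(a u₁), √(b u₂), √k)` and `(√(a v₁), √(b v₂), √k)`. For `k = 0` it is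
concavity of the geometric mean; the slack `k` is needed for the hyperbola centres in degree four.
-/
theorem sq_add_sqrt_mul_le {a b u₁ v₁ u₂ v₂ k : ℝ} (ha : 0 ≤ a) (hb : 0 ≤ b) (hu₁ : 0 ≤ u₁)
    (hv₁ : 0 ≤ v₁) (hu₂ : 0 ≤ u₂) (hv₂ : 0 ≤ v₂) (hk : 0 ≤ k) :
    (a * √(u₁ * v₁) + b * √(u₂ * v₂) + k) ^ 2 ≤
      (a * u₁ + b * u₂ + k) * (a * v₁ + b * v₂ + k) := by
  rw [Real.sqrt_mul hu₁, Real.sqrt_mul hu₂]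
  obtain ⟨p, hp, rfl⟩ : ∃ p, 0 ≤ p ∧ p ^ 2 = u₁ := ⟨√u₁, Real.sqrt_nonneg _, Real.sq_sqrt hu₁⟩
  obtain ⟨q, hq, rfl⟩ : ∃ p, 0 ≤ p ∧ p ^ 2 = v₁ := ⟨√v₁, Real.sqrt_nonneg _, Real.sq_sqrt hv₁⟩
  obtain ⟨r, hr, rfl⟩ : ∃ p, 0 ≤ p ∧ p ^ 2 = u₂ := ⟨√u₂, Real.sqrt_nonneg _, Real.sq_sqrt hu₂⟩
  obtain ⟨s, hs, rfl⟩ : ∃ p, 0 ≤ p ∧ p ^ 2 = v₂ := ⟨√v₂, Real.sqrt_nonneg _, Real.sq_sqrt hv₂⟩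
  simp only [Real.sqrt_sq hp, Real.sqrt_sq hq, Real.sqrt_sq hr, Real.sqrt_sq hs]
  have h1 := mul_nonneg (mul_nonneg ha hb) (sq_nonneg (p * s - r * q))
  have h2 := mul_nonneg (mul_nonneg ha hk) (sq_nonneg (p - q))
  have h3 := mul_nonneg (mul_nonneg hb hk) (sq_nonneg (r - s))
  nlinarith

/-- The reciprocal of a product of positive concave functions is convex: the geometric mean is
concave and monotone, and `t ↦ t⁻²` is convex and decreasing. -/
theorem inv_mul_le_of_concave {a b u₁ v₁ u₂ v₂ u v : ℝ} (ha : 0 ≤ a) (hb : 0 ≤ b) (hab : a + b = 1)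
    (hu₁ : 0 < u₁) (hv₁ : 0 < v₁) (hu₂ : 0 < u₂) (hv₂ : 0 < v₂)
    (hu : a * u₁ + b * u₂ ≤ u) (hv : a * v₁ + b * v₂ ≤ v) :
    (u * v)⁻¹ ≤ a * (u₁ * v₁)⁻¹ + b * (u₂ * v₂)⁻¹ := by
  have hp := Real.sqrt_pos.2 (mul_pos hu₁ hv₁)
  have hq := Real.sqrt_pos.2 (mul_pos hu₂ hv₂)
  have h0 := sq_add_sqrt_mul_le ha hb hu₁.le hv₁.le hu₂.le hv₂.le le_rfl
  have hpp := Real.mul_self_sqrt (mul_pos hu₁ hv₁).le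
  have hqq := Real.mul_self_sqrt (mul_pos hu₂ hv₂).le
  set p := √(u₁ * v₁)
  set q := √(u₂ * v₂)
  have hpos : ∀ x y : ℝ, 0 < x → 0 < y → 0 < a * x + b * y := by
    intro x y hx hy
    rcases ha.eq_or_lt with h | h
    · subst h
      have : b = 1 := by linarith
      subst this; simpa using hy
    · have := mul_pos h hx
      have := mul_nonneg hb hy.le
      linarith
  have hm := hpos p q hp hq
  have h1 : (u * v)⁻¹ ≤ ((a * p + b * q) ^ 2)⁻¹ := by
    refine inv_anti₀ (by positivity) ?_
    refine le_trans (by simpa using h0) ?_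
    exact mul_le_mul hu hv (hpos _ _ hv₁ hv₂).le ((hpos _ _ hu₁ hu₂).le.trans hu)
  refine h1.trans ?_
  rw [← hpp, ← hqq]
  have h2 : p * q ≤ (a * p + b * q) * (a * q + b * p) := by
    have hb' : b = 1 - a := by linarith
    have := mul_nonneg (mul_nonneg ha hb) (sq_nonneg (p - q))
    subst hb'
    nlinarith
  have h3 : (a * q + b * p) ^ 2 ≤ a * q ^ 2 + b * p ^ 2 := by
    have hb' : b = 1 - a := by linarith
    have := mul_nonneg (mul_nonneg ha hb) (sq_nonneg (p - q))
    subst hb'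
    nlinarith
  have h4 : (p * q) ^ 2 ≤ (a * p + b * q) ^ 2 * (a * q ^ 2 + b * p ^ 2) := by
    calc (p * q) ^ 2 ≤ ((a * p + b * q) * (a * q + b * p)) ^ 2 := by gcongr
      _ = (a * p + b * q) ^ 2 * (a * q + b * p) ^ 2 := by ring
      _ ≤ _ := by gcongr
  rw [inv_le_iff_one_le_mul₀ (by positivity)]
  have h5 : (a * (p * p)⁻¹ + b * (q * q)⁻¹) * (a * p + b * q) ^ 2 =
      (a * p + b * q) ^ 2 * (a * q ^ 2 + b * p ^ 2) / (p * q) ^ 2 := by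
    field_simp
  rw [h5, le_div_iff₀ (by positivity)]
  linarith

theorem lt_add_of_sq_lt_mul {g x y : ℝ} (hx : 0 < x) (hy : 0 < y) (h : g ^ 2 < x * y) :
    2 * g < x + y := by
  by_contra hc
  have h1 : (x + y) ^ 2 ≤ (2 * g) ^ 2 := by
    apply pow_le_pow_left₀ (by positivity)
    linarith
  nlinarith [sq_nonneg (x - y)]

theorem sq_lt_mul_combo {g a b x₁ y₁ x₂ y₂ : ℝ} (hg : 0 ≤ g) (ha : 0 ≤ a) (hb : 0 ≤ b)
    (hab : a + b = 1) (hx₁ : 0 < x₁) (hy₁ : 0 < y₁) (hx₂ : 0 < x₂) (hy₂ : 0 < y₂)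
    (h₁ : g ^ 2 < x₁ * y₁) (h₂ : g ^ 2 < x₂ * y₂) :
    g ^ 2 < (a * x₁ + b * x₂) * (a * y₁ + b * y₂) := by
  have h0 := sq_add_sqrt_mul_le ha hb hx₁.le hy₁.le hx₂.le hy₂.le le_rfl
  simp only [add_zero] at h0
  refine lt_of_lt_of_le ?_ h0
  have e₁ : g < √(x₁ * y₁) := Real.lt_sqrt_of_sq_lt h₁
  have e₂ : g < √(x₂ * y₂) := Real.lt_sqrt_of_sq_lt h₂
  refine pow_lt_pow_left₀ ?_ hg two_ne_zero
  rcases ha.eq_or_lt with h | h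
  · have : b = 1 := by linarith
    subst this; rw [← h]; simpa using e₂
  · calc g = a * g + b * g := by rw [← add_mul, hab, one_mul]
      _ < _ := add_lt_add_of_lt_of_le (mul_lt_mul_of_pos_left e₁ h)
        (mul_le_mul_of_nonneg_left e₂.le hb)

/-- Convexity of the graph `z = (g² (x + y) + e) / (x y - g²)`. -/
theorem graph_convex {g e a b x₁ y₁ x₂ y₂ : ℝ} (hg : 0 ≤ g) (he : -2 * g ^ 3 ≤ e) (ha : 0 ≤ a)
    (hb : 0 ≤ b) (hab : a + b = 1) (hx₁ : 0 < x₁) (hy₁ : 0 < y₁) (hx₂ : 0 < x₂) (hy₂ : 0 < y₂)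
    (h₁ : g ^ 2 < x₁ * y₁) (h₂ : g ^ 2 < x₂ * y₂) :
    (g ^ 2 * ((a * x₁ + b * x₂) + (a * y₁ + b * y₂)) + e) /
        ((a * x₁ + b * x₂) * (a * y₁ + b * y₂) - g ^ 2) ≤
      a * ((g ^ 2 * (x₁ + y₁) + e) / (x₁ * y₁ - g ^ 2)) +
        b * ((g ^ 2 * (x₂ + y₂) + e) / (x₂ * y₂ - g ^ 2)) := by
  have h := sq_lt_mul_combo hg ha hb hab hx₁ hy₁ hx₂ hy₂ h₁ h₂
  -- With `s = x + y - 2 g` and `K = (x y - g²) / s` the graph is `g² / K + (e + 2 g³) / (s K)`. The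
  -- bound on `e` makes both coefficients nonnegative; `s` is affine, so concavity of `K` suffices.
  have decomp : ∀ x y : ℝ, 0 < x + y - 2 * g → 0 < x * y - g ^ 2 →
      (g ^ 2 * (x + y) + e) / (x * y - g ^ 2) =
        g ^ 2 * (1 * ((x * y - g ^ 2) / (x + y - 2 * g)))⁻¹ +
        (e + 2 * g ^ 3) * ((x + y - 2 * g) * ((x * y - g ^ 2) / (x + y - 2 * g)))⁻¹ := by
    intro x y hs hd
    obtain ⟨s, rfl⟩ : ∃ s, y = s - x + 2 * g := ⟨x + y - 2 * g, by ring⟩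
    have e0 : x + (s - x + 2 * g) - 2 * g = s := by ring
    rw [e0] at hs ⊢
    rw [one_mul, mul_div_cancel₀ _ hs.ne', inv_div]
    field_simp
    ring
  have hs₁ : 0 < x₁ + y₁ - 2 * g := sub_pos.2 (lt_add_of_sq_lt_mul hx₁ hy₁ h₁)
  have hs₂ : 0 < x₂ + y₂ - 2 * g := sub_pos.2 (lt_add_of_sq_lt_mul hx₂ hy₂ h₂)
  have hs : a * (x₁ + y₁ - 2 * g) + b * (x₂ + y₂ - 2 * g) =
      (a * x₁ + b * x₂) + (a * y₁ + b * y₂) - 2 * g := by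
    linear_combination (-2 * g) * hab
  have hs0 : 0 < (a * x₁ + b * x₂) + (a * y₁ + b * y₂) - 2 * g := by
    rw [← hs]
    rcases ha.eq_or_lt with h0 | h0
    · have : b = 1 := by linarith
      subst this; rw [← h0]; simpa using hs₂
    · have := mul_pos h0 hs₁
      have := mul_nonneg hb hs₂.le
      linarith
  have hd₁ := sub_pos.2 h₁
  have hd₂ := sub_pos.2 h₂
  rw [decomp _ _ hs₁ hd₁, decomp _ _ hs₂ hd₂, decomp _ _ hs0 (sub_pos.2 h)]
  -- Setting `X = x - g`, `Y = y - g` gives `K = g + X Y / (X + Y)`, a harmonic mean up to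
  -- constants; its concavity defect is a square over `s t`.
  have hK : a * ((x₁ * y₁ - g ^ 2) / (x₁ + y₁ - 2 * g)) +
      b * ((x₂ * y₂ - g ^ 2) / (x₂ + y₂ - 2 * g)) ≤
      ((a * x₁ + b * x₂) * (a * y₁ + b * y₂) - g ^ 2) /
        ((a * x₁ + b * x₂) + (a * y₁ + b * y₂) - 2 * g) := by
    rw [le_div_iff₀ hs0, ← hs]
    have hb' : b = 1 - a := by linarith
    have e1 : ∀ s t : ℝ, 0 < s → 0 < t → x₁ + y₁ - 2 * g = s → x₂ + y₂ - 2 * g = t →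
        (a * x₁ + b * x₂) * (a * y₁ + b * y₂) - g ^ 2 -
          (a * ((x₁ * y₁ - g ^ 2) / s) + b * ((x₂ * y₂ - g ^ 2) / t)) * (a * s + b * t) =
        a * b * ((x₁ - g) * (y₂ - g) - (x₂ - g) * (y₁ - g)) ^ 2 / (s * t) := by
      intro s t hs ht h₁ h₂
      obtain rfl : y₁ = s - x₁ + 2 * g := by linarith
      obtain rfl : y₂ = t - x₂ + 2 * g := by linarith
      subst hb'
      field_simp
      ring
    have e1 := e1 _ _ hs₁ hs₂ rfl rfl
    have e2 : 0 ≤ a * b * ((x₁ - g) * (y₂ - g) - (x₂ - g) * (y₁ - g)) ^ 2 /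
        ((x₁ + y₁ - 2 * g) * (x₂ + y₂ - 2 * g)) := by positivity
    linarith
  have i1 := inv_mul_le_of_concave (u₁ := 1) (u₂ := 1) (u := 1) ha hb hab one_pos
    (div_pos hd₁ hs₁) one_pos (div_pos hd₂ hs₂) (by linarith) hK
  have i2 := inv_mul_le_of_concave ha hb hab hs₁ (div_pos hd₁ hs₁) hs₂ (div_pos hd₂ hs₂) hs.le hK
  have j1 := mul_le_mul_of_nonneg_left i1 (sq_nonneg g)
  have j2 := mul_le_mul_of_nonneg_left i2 (show 0 ≤ e + 2 * g ^ 3 by linarith)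
  linarith

end Inequalities

/-! ### The extremal and concavity estimates for degree four. -/

section Quartic

theorem neg_two_mul_cube_le {g x : ℝ} (hg : 0 ≤ g) (hx : g ≤ x) :
    -2 * g ^ 3 ≤ x ^ 3 - 3 * g ^ 2 * x := by
  have : x ^ 3 - 3 * g ^ 2 * x + 2 * g ^ 3 = (x - g) ^ 2 * (x + 2 * g) := by ring
  have : 0 ≤ (x - g) ^ 2 * (x + 2 * g) := mul_nonneg (sq_nonneg _) (by linarith)
  linarith

/-- On the surface `a b c - g² (a + b + c) = c₁` the function `g² σ₂ + c₁ σ₁` is minimal at the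
diagonal point. -/
theorem sigma_bound_on_cubic {g x a b c c₁ : ℝ} (hg : 0 ≤ g) (hx : g ≤ x)
    (hc₁ : c₁ = x ^ 3 - 3 * g ^ 2 * x) (ha : 0 ≤ a) (hb : 0 ≤ b) (hc : 0 ≤ c)
    (hab : g ^ 2 ≤ a * b) (hac : g ^ 2 ≤ a * c) (hbc : g ^ 2 ≤ b * c)
    (h : a * b * c - g ^ 2 * (a + b + c) - c₁ = 0) :
    3 * g ^ 2 * x ^ 2 + 3 * c₁ * x ≤ g ^ 2 * (a * b + a * c + b * c) + c₁ * (a + b + c) := by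
  have hlow : -2 * g ^ 3 ≤ c₁ := hc₁ ▸ neg_two_mul_cube_le hg hx
  have hx0 : 0 ≤ x := hg.trans hx
  rcases ha.eq_or_lt with ha0 | ha0
  · have hg0 : g = 0 := by
      rw [← ha0, zero_mul] at hab
      exact pow_eq_zero_iff two_ne_zero |>.1 (le_antisymm hab (sq_nonneg g))
    subst hg0
    rw [← ha0] at h
    have : c₁ = 0 := by linarith
    subst this
    simp
  · have hgbc : g ≤ (b + c) / 2 := by
      have : (2 * g) ^ 2 ≤ (b + c) ^ 2 := by nlinarith [sq_nonneg (b - c)]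
      have := abs_le_of_sq_le_sq' this (by positivity)
      linarith
    -- `v` is chosen so that `(a, v, v)` lies on the same surface. Replacing `b` and `c` by `v` does
    -- not increase the objective, which leaves a problem in one variable.
    obtain ⟨v, ⟨hv1, hv2⟩, hv⟩ : ∃ v ∈ Set.Icc g ((b + c) / 2),
        a * v ^ 2 - 2 * g ^ 2 * v - (g ^ 2 * a + c₁) = 0 := by
      have hcont : ContinuousOn (fun v : ℝ => a * v ^ 2 - 2 * g ^ 2 * v - (g ^ 2 * a + c₁))
          (Set.Icc g ((b + c) / 2)) := by fun_prop
      refine intermediate_value_Icc hgbc hcont ⟨?_, ?_⟩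
      · nlinarith
      · nlinarith [mul_nonneg ha (sq_nonneg (b - c))]
    have hstep : 0 ≤ g ^ 4 + g ^ 2 * a ^ 2 + c₁ * a := by
      nlinarith [mul_nonneg (sub_nonneg.2 hlow) ha, sq_nonneg (g ^ 2 - g * a)]
    have hred : g ^ 2 * (v ^ 2 + 2 * a * v) + c₁ * (a + 2 * v) ≤
        g ^ 2 * (a * b + a * c + b * c) + c₁ * (a + b + c) := by
      have e : a * (g ^ 2 * (a * b + a * c + b * c) + c₁ * (a + b + c) -
          (g ^ 2 * (v ^ 2 + 2 * a * v) + c₁ * (a + 2 * v))) =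
          (b + c - 2 * v) * (g ^ 4 + g ^ 2 * a ^ 2 + c₁ * a) := by
        linear_combination g ^ 2 * h - g ^ 2 * hv
      have := mul_nonneg (show 0 ≤ b + c - 2 * v by linarith) hstep
      rw [← e] at this
      have := nonneg_of_mul_nonneg_right this ha0
      linarith
    refine le_trans ?_ hred
    have hv0 : 0 ≤ v := hg.trans hv1
    rcases hv1.eq_or_lt with hvg | hvg
    · subst hvg
      have hc₁' : c₁ = -2 * g ^ 3 := by linarith
      have : (x - g) ^ 2 * (x + 2 * g) = 0 := by linarith
      rcases mul_eq_zero.1 this with h0 | h0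
      · have : x = g := by
          have := pow_eq_zero_iff two_ne_zero |>.1 h0
          linarith
        subst this
        rw [hc₁']; nlinarith
      · have h1 : g = 0 := by linarith
        have h2 : x = 0 := by linarith
        subst h1; subst h2
        simp [hc₁']
    · have hpos : 0 < v ^ 2 - g ^ 2 := by nlinarith
      have hfac : 0 ≤ g ^ 2 * (v - x) ^ 2 + 2 * x * (x ^ 2 - g ^ 2) * v
          - 2 * g ^ 2 * (x ^ 2 - g ^ 2) + (x ^ 2 - g ^ 2) ^ 2 := by
        have hβ : 0 ≤ x ^ 2 - g ^ 2 := by nlinarith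
        have hxv : g ^ 2 ≤ x * v := by nlinarith
        nlinarith [mul_nonneg hβ (sub_nonneg.2 hxv), mul_nonneg (sq_nonneg g) (sq_nonneg (v - x)),
          sq_nonneg (x ^ 2 - g ^ 2)]
      -- The surface equation reads `a (v² - g²) = 2 g² v + c₁`, so this multiplier eliminates `a`;
      -- the result has a double zero at the diagonal value `v = x`.
      have e : (v ^ 2 - g ^ 2) * (g ^ 2 * (v ^ 2 + 2 * a * v) + c₁ * (a + 2 * v) -
          (3 * g ^ 2 * x ^ 2 + 3 * c₁ * x)) = (v - x) ^ 2 * (g ^ 2 * (v - x) ^ 2 +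
          2 * x * (x ^ 2 - g ^ 2) * v - 2 * g ^ 2 * (x ^ 2 - g ^ 2) + (x ^ 2 - g ^ 2) ^ 2) := by
        subst hc₁
        linear_combination (2 * g ^ 2 * v + (x ^ 3 - 3 * g ^ 2 * x)) * hv
      have h0 : 0 ≤ (v ^ 2 - g ^ 2) * (g ^ 2 * (v ^ 2 + 2 * a * v) + c₁ * (a + 2 * v) -
          (3 * g ^ 2 * x ^ 2 + 3 * c₁ * x)) := by rw [e]; positivity
      have := nonneg_of_mul_nonneg_right h0 hpos
      linarith

/-- A second order Taylor estimate for the square root of a quadratic polynomial with nonnegative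
discriminant, `r² - h q + 4 c h²` being its value at distance `h` to the left. -/
theorem sqrt_quadratic_le {c k r q h r₀ : ℝ} (hk : 0 ≤ k) (hr : 0 < r) (hq : 0 ≤ q)
    (hqr : q ^ 2 = 16 * (c * r ^ 2 + k)) (hh : 0 ≤ h) (hr₀ : 0 < r₀)
    (h₀ : r₀ ^ 2 = r ^ 2 - h * q + 4 * c * h ^ 2) (hq₀ : 0 ≤ q - 8 * c * h) :
    r₀ ≤ r - h * q / (2 * r) - 2 * k * h ^ 2 / r ^ 3 := by
  -- `e` and `G` are the first and second order terms divided by `r`. The claim becomes `(1 - e)² -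
  -- 2 G ≤ (1 - e - G)²` together with `0 ≤ 1 - e - G`.
  obtain ⟨e, he⟩ : ∃ e, e = q * h / (2 * r ^ 2) := ⟨_, rfl⟩
  obtain ⟨G, hG⟩ : ∃ G, G = 2 * k * h ^ 2 / r ^ 4 := ⟨_, rfl⟩
  have he0 : 0 ≤ e := by rw [he]; positivity
  have hG0 : 0 ≤ G := by rw [hG]; positivity
  have hc : c = q ^ 2 / (16 * r ^ 2) - k / r ^ 2 := by
    field_simp; linarith
  have h1 : r₀ ^ 2 = r ^ 2 * ((1 - e) ^ 2 - 2 * G) := by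
    rw [h₀, hc, he, hG]; field_simp; ring
  have h2 : h / r ^ 2 * (q - 8 * c * h) = 2 * (e * (1 - e) + 2 * G) := by
    rw [hc, he, hG]; field_simp; ring
  have h3 : 0 < (1 - e) ^ 2 - 2 * G := by
    have : 0 < r ^ 2 * ((1 - e) ^ 2 - 2 * G) := by rw [← h1]; positivity
    exact pos_of_mul_pos_right this (by positivity)
  have h4 : 0 ≤ e * (1 - e) + 2 * G := by
    have : 0 ≤ h / r ^ 2 * (q - 8 * c * h) := by positivity
    rw [h2] at this; linarith
  -- If `e > 1`, then `h4` gives `e (e - 1) ≤ 2 G < (e - 1)²`, which is absurd. This is where the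
  -- sign of the slope at the left end enters.
  have he1 : e ≤ 1 := by nlinarith
  have h5 : 0 ≤ 1 - e - G := by nlinarith
  have h6 : r - h * q / (2 * r) - 2 * k * h ^ 2 / r ^ 3 = r * (1 - e - G) := by
    rw [he, hG]; field_simp
  rw [h6]
  refine abs_le_of_sq_le_sq' ?_ (by positivity) |>.2
  rw [h1, mul_pow]
  refine mul_le_mul_of_nonneg_left ?_ (by positivity)
  nlinarith [mul_nonneg he0 hG0]

/-- For `T = m² - c₂ - √Q`, concavity of `√T` means `2 T T'' ≤ T'²`. As `T` vanishes at `t`, the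
Taylor estimate `sqrt_quadratic_le` gives `T + (m - t)² T'' / 2 ≤ (m - t) T'`; squaring and AM-GM
finish. -/
theorem sqrt_sub_sqrt_concaveOn {c₂ c₁ k t : ℝ} (hk : 0 ≤ c₁ ^ 2 - c₂ * k)
    (hQ : ∀ m, t ≤ m → 0 < 4 * c₂ * m ^ 2 + 4 * c₁ * m + k)
    (hQ' : ∀ m, t ≤ m → 0 ≤ 8 * c₂ * m + 4 * c₁)
    (ht : t ^ 2 - c₂ = √(4 * c₂ * t ^ 2 + 4 * c₁ * t + k))
    (hT : ∀ m, t < m → 0 < m ^ 2 - c₂ - √(4 * c₂ * m ^ 2 + 4 * c₁ * m + k)) :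
    ConcaveOn ℝ (Set.Ioi t)
      (fun m => √(m ^ 2 - c₂ - √(4 * c₂ * m ^ 2 + 4 * c₁ * m + k))) := by
  set Q : ℝ → ℝ := fun m => 4 * c₂ * m ^ 2 + 4 * c₁ * m + k with hQdef
  set K := c₁ ^ 2 - c₂ * k with hKdef
  have dQ : ∀ m, HasDerivAt Q (8 * c₂ * m + 4 * c₁) m := by
    intro m
    have h1 := ((hasDerivAt_id m).pow 2).const_mul (4 * c₂)
    have h2 := (hasDerivAt_id m).const_mul (4 * c₁)
    have := (h1.add h2).add_const k
    refine HasDerivAt.congr_deriv this ?_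
    simp; ring
  have dr : ∀ m, t ≤ m → HasDerivAt (fun m => √(Q m)) ((8 * c₂ * m + 4 * c₁) / (2 * √(Q m))) m :=
    fun m hm => (dQ m).sqrt (hQ m hm).ne'
  have dT : ∀ m, t ≤ m → HasDerivAt (fun m => m ^ 2 - c₂ - √(Q m))
      (2 * m - (8 * c₂ * m + 4 * c₁) / (2 * √(Q m))) m := by
    intro m hm
    have h1 := (((hasDerivAt_id m).pow 2).sub_const c₂).sub (dr m hm)
    refine HasDerivAt.congr_deriv h1 ?_
    simp
  have dT1 : ∀ m, t ≤ m → HasDerivAt (fun m => 2 * m - (8 * c₂ * m + 4 * c₁) / (2 * √(Q m)))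
      (2 + 4 * K / √(Q m) ^ 3) m := by
    intro m hm
    have hr := Real.sqrt_pos.2 (hQ m hm)
    have hrr : √(Q m) ^ 2 = 4 * c₂ * m ^ 2 + 4 * c₁ * m + k := Real.sq_sqrt (hQ m hm).le
    have h1 : HasDerivAt (fun m : ℝ => 8 * c₂ * m + 4 * c₁) (8 * c₂) m := by
      simpa using ((hasDerivAt_id m).const_mul (8 * c₂)).add_const (4 * c₁)
    have h2 := ((hasDerivAt_id m).const_mul 2).sub (h1.div ((dr m hm).const_mul 2) (by positivity))
    refine HasDerivAt.congr_deriv h2 ?_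
    generalize √(Q m) = r at hr hrr
    field_simp
    rw [hKdef]
    linear_combination (-16 * c₂) * hrr
  refine concaveOn_of_hasDerivWithinAt2_nonpos (convex_Ioi t)
    (f' := fun m => (2 * m - (8 * c₂ * m + 4 * c₁) / (2 * √(Q m))) /
      (2 * √(m ^ 2 - c₂ - √(Q m))))
    (f'' := fun m => ((2 + 4 * K / √(Q m) ^ 3) * (2 * √(m ^ 2 - c₂ - √(Q m))) -
      (2 * m - (8 * c₂ * m + 4 * c₁) / (2 * √(Q m))) *
        (2 * ((2 * m - (8 * c₂ * m + 4 * c₁) / (2 * √(Q m))) / (2 * √(m ^ 2 - c₂ - √(Q m)))))) /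
      (2 * √(m ^ 2 - c₂ - √(Q m))) ^ 2) ?_ ?_ ?_ ?_
  · fun_prop
  · intro m hm
    rw [interior_Ioi] at hm ⊢
    exact ((dT m (le_of_lt hm)).sqrt (hT m hm).ne').hasDerivWithinAt
  · intro m hm
    rw [interior_Ioi] at hm ⊢
    have hpos := Real.sqrt_pos.2 (hT m hm)
    exact ((dT1 m (le_of_lt hm)).div (((dT m (le_of_lt hm)).sqrt (hT m hm).ne').const_mul 2)
      (by positivity)).hasDerivWithinAt
  · intro m hm
    rw [interior_Ioi] at hm
    have hm' : t < m := hm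
    have hTm := hT m hm
    have hpos := Real.sqrt_pos.2 hTm
    have hr := Real.sqrt_pos.2 (hQ m hm'.le)
    have hrr : √(Q m) ^ 2 = 4 * c₂ * m ^ 2 + 4 * c₁ * m + k := Real.sq_sqrt (hQ m hm'.le).le
    have hr₀ := Real.sqrt_pos.2 (hQ t le_rfl)
    have hrr₀ : √(Q t) ^ 2 = 4 * c₂ * t ^ 2 + 4 * c₁ * t + k := Real.sq_sqrt (hQ t le_rfl).le
    have hTs : √(m ^ 2 - c₂ - √(Q m)) ^ 2 = m ^ 2 - c₂ - √(Q m) := Real.sq_sqrt hTm.le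
    change t ^ 2 - c₂ = √(Q t) at ht
    have key := sqrt_quadratic_le (c := c₂) (k := K) (r := √(Q m)) (q := 8 * c₂ * m + 4 * c₁)
      (h := m - t) (r₀ := √(Q t)) hk hr (hQ' m hm'.le) (by rw [hrr, hKdef]; ring)
      (by linarith) hr₀ (by rw [hrr, hrr₀]; ring) (by have := hQ' t le_rfl; linarith)
    rw [← ht] at key
    generalize √(m ^ 2 - c₂ - √(Q m)) = S at hpos hTs
    have hS : 0 < S ^ 2 := by positivity
    set q := 8 * c₂ * m + 4 * c₁
    generalize √(Q m) = r at *
    obtain ⟨T₁, hT₁⟩ : ∃ T₁, T₁ = 2 * m - q / (2 * r) := ⟨_, rfl⟩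
    obtain ⟨T₂, hT₂⟩ : ∃ T₂, T₂ = 2 + 4 * K / r ^ 3 := ⟨_, rfl⟩
    have hT₂0 : 0 < T₂ := by rw [hT₂]; positivity
    have htay : S ^ 2 + (m - t) ^ 2 * T₂ / 2 ≤ (m - t) * T₁ := by
      have e1 : (m - t) * q / (2 * r) = (m - t) * (q / (2 * r)) := by ring
      have e2 : 2 * K * (m - t) ^ 2 / r ^ 3 = (m - t) ^ 2 * (4 * K / r ^ 3) / 2 := by ring
      rw [e1, e2] at key
      rw [hT₁, hT₂, hTs]
      nlinarith
    have hmt : 0 < m - t := sub_pos.2 hm'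
    have hdisc : 2 * S ^ 2 * T₂ ≤ T₁ ^ 2 := by
      have h1 : (S ^ 2 + (m - t) ^ 2 * T₂ / 2) ^ 2 ≤ ((m - t) * T₁) ^ 2 := by
        gcongr
      have h2 : (m - t) ^ 2 * (2 * S ^ 2 * T₂) ≤ (m - t) ^ 2 * T₁ ^ 2 := by
        nlinarith [sq_nonneg (S ^ 2 - (m - t) ^ 2 * T₂ / 2)]
      exact le_of_mul_le_mul_left h2 (by positivity)
    rw [← hT₁, ← hT₂]
    refine div_nonpos_of_nonpos_of_nonneg ?_ (by positivity)
    have e : T₂ * (2 * S) - T₁ * (2 * (T₁ / (2 * S))) = (2 * S ^ 2 * T₂ - T₁ ^ 2) / S := by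
      field_simp
    rw [e]
    exact div_nonpos_of_nonpos_of_nonneg (by linarith) hpos.le

end Quartic

/-! ### Positivity helpers, then the level sets in degrees two and three. -/

section Regions

open Function

theorem nonneg_of_mem_closure {X : Type*} [TopologicalSpace X] {P : Set X} {g : X → ℝ}
    (hg : Continuous g) (h : ∀ l ∈ P, 0 < g l) {l : X} (hl : l ∈ closure P) : 0 ≤ g l :=
  closure_minimal (fun k hk => (h k hk).le) (isClosed_le continuous_const hg) hl

theorem nonpos_of_large_mul_lt {c y : ℝ} (h : ∀ M : ℝ, ∃ x, M < x ∧ x * y < c) : y ≤ 0 := by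
  by_contra hy
  rw [not_le] at hy
  obtain ⟨x, hx, hxy⟩ := h (c / y)
  rw [div_lt_iff₀ hy] at hx
  exact lt_asymm hx hxy

theorem add_pos_of_combo {a b x y : ℝ} (ha : 0 ≤ a) (hb : 0 ≤ b) (hab : a + b = 1) (hx : 0 < x)
    (hy : 0 < y) : 0 < a * x + b * y := by
  rcases ha.eq_or_lt with h | h
  · have : b = 1 := by linarith
    subst this; rw [← h]; simpa using hy
  · have := mul_pos h hx
    have := mul_nonneg hb hy.le
    linarith

theorem lt_combo {a b x y u v : ℝ} (ha : 0 ≤ a) (hb : 0 ≤ b) (hab : a + b = 1) (hx : x < u)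
    (hy : y < v) : a * x + b * y < a * u + b * v := by
  have := add_pos_of_combo ha hb hab (sub_pos.2 hx) (sub_pos.2 hy)
  linarith

/-! ### Degree two -/

theorem invSigma_two (c₀ : ℝ) (l : Fin 2 → ℝ) : invSigma ![c₀, 0] l = l 0 * l 1 - c₀ := by
  simp [invSigma, sigmaSymm, MvPolynomial.esymm, Fin.sum_univ_succ, Fin.prod_univ_succ]

theorem pairForm_two (c₀ : ℝ) (l : Fin 2 → ℝ) :
    PairForm (invSigma ![c₀, 0]) 0 1 l 1 0 (-c₀) := by
  intro x y
  simp [invSigma_two]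
  ring

theorem hasConvexLevelSet_two {c₀ : ℝ} (h : 0 < c₀) : HasConvexLevelSet (invSigma ![c₀, 0]) := by
  have hf : Continuous (invSigma ![c₀, 0]) := by
    rw [funext (invSigma_two c₀)]; fun_prop
  refine hasConvexLevelSet_of_region (P := {l | 0 < l 0 ∧ 0 < l 1}) hf ?_ ?_ ?_ ?_ ?_ ?_ ?_ ?_
  · intro i j hij l
    refine ⟨1, 0, -c₀, ?_⟩
    fin_cases i <;> fin_cases j <;> first
      | exact absurd rfl hij
      | exact pairForm_two c₀ l
      | exact (pairForm_two c₀ l).swap (by decide)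
  · simp only [Set.ofPred_and]
    apply IsOpen.inter
    all_goals exact isOpen_lt (by fun_prop) (by fun_prop)
  · intro l hl h0
    have h1 := nonneg_of_mem_closure (g := fun l => l 0) (by fun_prop) (fun k hk => hk.1) hl
    have h2 := nonneg_of_mem_closure (g := fun l => l 1) (by fun_prop) (fun k hk => hk.2) hl
    rw [invSigma_two] at h0
    have h3 : 0 < l 0 * l 1 := by linarith
    exact ⟨pos_of_mul_pos_left h3 h2, pos_of_mul_pos_right h3 h1⟩
  · rintro l ⟨h1, h2⟩ i
    fin_cases i
    exacts [h1, h2]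
  · intro L hL l hl
    refine ⟨?_, ?_⟩
    · simpa using hL.upper_branch (by decide) hl (pairForm_two c₀ l)
    · simpa using hL.upper_branch (by decide) hl ((pairForm_two c₀ l).swap (by decide))
  · rintro l ⟨h1, h2⟩ s hs
    simp only [invSigma_two]
    nlinarith [mul_pos h1 hs, mul_pos h2 hs]
  · refine ⟨√c₀, ⟨Real.sqrt_pos.2 h, Real.sqrt_pos.2 h⟩, ?_⟩
    simp [invSigma_two, Real.mul_self_sqrt h.le]
  · rintro l ⟨⟨h1, h2⟩, h3⟩ k ⟨⟨k1, k2⟩, k3⟩ a b ha hb hab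
    simp only [Set.mem_ofPred_eq, invSigma_two] at h3 k3
    have hs : √c₀ ^ 2 = c₀ := Real.sq_sqrt h.le
    have := sq_lt_mul_combo (Real.sqrt_nonneg c₀) ha hb hab h1 h2 k1 k2 (by linarith) (by linarith)
    refine ⟨⟨?_, ?_⟩, ?_⟩
    · exact add_pos_of_combo ha hb hab h1 k1
    · exact add_pos_of_combo ha hb hab h2 k2
    · simp only [Set.mem_ofPred_eq, invSigma_two, Pi.add_apply, Pi.smul_apply, smul_eq_mul]
      linarith

/-! ### Degree three -/

theorem invSigma_three (c₀ c₁ : ℝ) (l : Fin 3 → ℝ) :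
    invSigma ![c₀, c₁, 0] l = l 0 * l 1 * l 2 - c₁ * (l 0 + l 1 + l 2) - c₀ := by
  simp [invSigma, sigmaSymm, MvPolynomial.esymm, Fin.sum_univ_succ, Fin.prod_univ_succ,
    Finset.powersetCard_one]
  ring

theorem pairForm_three_zero_one (c₀ c₁ : ℝ) (l : Fin 3 → ℝ) :
    PairForm (invSigma ![c₀, c₁, 0]) 0 1 l (l 2) (-c₁) (-c₁ * l 2 - c₀) := by
  intro x y
  simp [invSigma_three]
  ring

theorem pairForm_three_zero_two (c₀ c₁ : ℝ) (l : Fin 3 → ℝ) :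
    PairForm (invSigma ![c₀, c₁, 0]) 0 2 l (l 1) (-c₁) (-c₁ * l 1 - c₀) := by
  intro x y
  simp [invSigma_three]
  ring

theorem pairForm_three_one_two (c₀ c₁ : ℝ) (l : Fin 3 → ℝ) :
    PairForm (invSigma ![c₀, c₁, 0]) 1 2 l (l 0) (-c₁) (-c₁ * l 0 - c₀) := by
  intro x y
  simp [invSigma_three]
  ring

/-- The region of `ℝ³` in which all partial derivatives of the cubic are positive. -/
def cubicRegion (g : ℝ) : Set (Fin 3 → ℝ) :=
  {l | (0 < l 0 ∧ 0 < l 1 ∧ 0 < l 2) ∧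
    (g ^ 2 < l 0 * l 1 ∧ g ^ 2 < l 0 * l 2 ∧ g ^ 2 < l 1 * l 2)}

/-- The sign conditions from the three planes show that `l 2 < 0` forces `l 0 < 0`. But `l 0` can be
made large along a hyperbola with `l 2` fixed, so `l 2` is positive, and the same conditions give
the rest. -/
theorem levelSet_subset_cubicRegion {g c₀ : ℝ} {L : Set (Fin 3 → ℝ)}
    (hL : IsLevelSetOf (invSigma ![c₀, g ^ 2, 0]) L) : L ⊆ cubicRegion g := by
  have h01 := fun l (hl : l ∈ L) => hL.mul_pos (by decide) hl (pairForm_three_zero_one c₀ (g ^ 2) l)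
  have h10 := fun l (hl : l ∈ L) => hL.mul_pos (by decide) hl
    ((pairForm_three_zero_one c₀ (g ^ 2) l).swap (by decide))
  have h02 := fun l (hl : l ∈ L) => hL.mul_pos (by decide) hl (pairForm_three_zero_two c₀ (g ^ 2) l)
  have h20 := fun l (hl : l ∈ L) => hL.mul_pos (by decide) hl
    ((pairForm_three_zero_two c₀ (g ^ 2) l).swap (by decide))
  have h12 := fun l (hl : l ∈ L) => hL.mul_pos (by decide) hl (pairForm_three_one_two c₀ (g ^ 2) l)
  have hneg : ∀ l ∈ L, l 2 < 0 → l 0 < 0 := by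
    intro l hl h2
    have e1 := neg_of_mul_pos_right (h01 l hl) h2.le
    have e2 := h12 l hl
    have e3 := h02 l hl
    have e4 := h20 l hl
    have e5 : l 1 < 0 := by
      by_contra hc
      have := pos_of_mul_pos_right e4 (not_lt.1 hc)
      have := neg_of_mul_pos_right (h10 l hl) h2.le
      nlinarith
    have := neg_of_mul_pos_right e3 e5.le
    by_contra hc
    have := pos_of_mul_pos_right e2 (not_lt.1 hc)
    nlinarith
  intro l hl
  have h2 : 0 < l 2 := by
    by_contra hc
    have hne : l 2 ≠ 0 := hL.leading_ne_zero hl (pairForm_three_zero_one c₀ (g ^ 2) l)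
    obtain ⟨x, y, hx, hxy⟩ := hL.exists_large (by decide) hl (pairForm_three_zero_one c₀ (g ^ 2) l) 0
    have := hneg _ hxy (by simpa [update_apply] using lt_of_le_of_ne (not_lt.1 hc) hne)
    simp at this
    linarith
  have e1 := pos_of_mul_pos_right (h01 l hl) h2.le
  have e2 := pos_of_mul_pos_right (h10 l hl) h2.le
  have h1 : 0 < l 1 := pos_of_mul_pos_right (a := l 2) (by nlinarith [sq_nonneg g]) h2.le
  have h0 : 0 < l 0 := pos_of_mul_pos_right (a := l 2) (by nlinarith [sq_nonneg g]) h2.le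
  have e3 := pos_of_mul_pos_right (h02 l hl) h1.le
  exact ⟨⟨h0, h1, h2⟩, by linarith, by linarith, by linarith⟩

theorem hasConvexLevelSet_three {g c₀ : ℝ} (hg : 0 ≤ g) (h : -2 * g ^ 3 < c₀) :
    HasConvexLevelSet (invSigma ![c₀, g ^ 2, 0]) := by
  have hf : Continuous (invSigma ![c₀, g ^ 2, 0]) := by
    rw [funext (invSigma_three c₀ (g ^ 2))]; fun_prop
  refine hasConvexLevelSet_of_region (P := cubicRegion g) hf ?_ ?_ ?_ ?_
    (fun L hL => levelSet_subset_cubicRegion hL) ?_ ?_ ?_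
  · intro i j hij l
    fin_cases i <;> fin_cases j <;> first
      | exact absurd rfl hij
      | exact ⟨_, _, _, pairForm_three_zero_one c₀ (g ^ 2) l⟩
      | exact ⟨_, _, _, pairForm_three_zero_two c₀ (g ^ 2) l⟩
      | exact ⟨_, _, _, pairForm_three_one_two c₀ (g ^ 2) l⟩
      | exact ⟨_, _, _, (pairForm_three_zero_one c₀ (g ^ 2) l).swap (by decide)⟩
      | exact ⟨_, _, _, (pairForm_three_zero_two c₀ (g ^ 2) l).swap (by decide)⟩
      | exact ⟨_, _, _, (pairForm_three_one_two c₀ (g ^ 2) l).swap (by decide)⟩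
  · simp only [cubicRegion, Set.ofPred_and]
    repeat' apply IsOpen.inter
    all_goals exact isOpen_lt (by fun_prop) (by fun_prop)
  · intro l hl h0
    have a0 := nonneg_of_mem_closure (g := fun l => l 0) (by fun_prop) (fun k hk => hk.1.1) hl
    have a1 := nonneg_of_mem_closure (g := fun l => l 1) (by fun_prop) (fun k hk => hk.1.2.1) hl
    have a2 := nonneg_of_mem_closure (g := fun l => l 2) (by fun_prop) (fun k hk => hk.1.2.2) hl
    have b01 := nonneg_of_mem_closure (g := fun l => l 0 * l 1 - g ^ 2) (by fun_prop)
      (fun k hk => sub_pos.2 hk.2.1) hl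
    have b02 := nonneg_of_mem_closure (g := fun l => l 0 * l 2 - g ^ 2) (by fun_prop)
      (fun k hk => sub_pos.2 hk.2.2.1) hl
    have b12 := nonneg_of_mem_closure (g := fun l => l 1 * l 2 - g ^ 2) (by fun_prop)
      (fun k hk => sub_pos.2 hk.2.2.2) hl
    rw [invSigma_three] at h0
    have key : ∀ x y z : ℝ, 0 ≤ x → 0 ≤ y → 0 ≤ x * y - g ^ 2 →
        0 ≤ x * y * z - g ^ 2 * (x + y + z) - c₀ → g ^ 2 < x * y := by
      intro x y z hx hy hxy hz
      -- Where `x y = g²`, the cubic equals `-g² (x + y) - c₀ ≤ -2 g³ - c₀ < 0`: this is the role of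
      -- the bound on `c₀`.
      refine lt_of_le_of_ne (by linarith) fun heq => ?_
      have hs : 2 * g ≤ x + y := by
        have := abs_le_of_sq_le_sq' (show (2 * g) ^ 2 ≤ (x + y) ^ 2 by nlinarith [sq_nonneg (x - y)])
          (by positivity)
        exact this.2
      rw [← heq] at hz
      nlinarith [mul_le_mul_of_nonneg_left hs (sq_nonneg g)]
    have k01 := key (l 0) (l 1) (l 2) a0 a1 b01 (by linarith)
    have k02 := key (l 0) (l 2) (l 1) a0 a2 b02 (by linarith)
    have k12 := key (l 1) (l 2) (l 0) a1 a2 b12 (by linarith)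
    have hg2 := sq_nonneg g
    exact ⟨⟨pos_of_mul_pos_left (hg2.trans_lt k01) a1, pos_of_mul_pos_right (hg2.trans_lt k01) a0,
      pos_of_mul_pos_right (hg2.trans_lt k02) a0⟩, k01, k02, k12⟩
  · rintro l ⟨⟨h0, h1, h2⟩, -⟩ i
    fin_cases i
    exacts [h0, h1, h2]
  · rintro l ⟨⟨h0, h1, h2⟩, h01, h02, h12⟩ s hs
    simp only [invSigma_three]
    have := mul_pos hs (sub_pos.2 h01)
    have := mul_pos hs (sub_pos.2 h02)
    have := mul_pos hs (sub_pos.2 h12)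
    have := mul_pos (pow_pos hs 2) h0
    have := mul_pos (pow_pos hs 2) h1
    have := mul_pos (pow_pos hs 2) h2
    have := pow_pos hs 3
    nlinarith
  · obtain ⟨t, ⟨ht1, ht2⟩, ht⟩ : ∃ t ∈ Set.Icc g (g ^ 2 * 3 + |c₀| + 1 + g),
        t ^ 3 - 3 * g ^ 2 * t - c₀ = 0 := by
      have hcont : ContinuousOn (fun t : ℝ => t ^ 3 - 3 * g ^ 2 * t - c₀)
          (Set.Icc g (g ^ 2 * 3 + |c₀| + 1 + g)) := by fun_prop
      have hc := abs_nonneg c₀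
      have hc' := le_abs_self c₀
      have hg2 := sq_nonneg g
      refine intermediate_value_Icc (by linarith) hcont ⟨by nlinarith, ?_⟩
      obtain ⟨N, hN⟩ : ∃ N, N = g ^ 2 * 3 + |c₀| + 1 + g := ⟨_, rfl⟩
      rw [← hN]
      have h1 : 1 ≤ N := by linarith
      have h2 : |c₀| + 1 ≤ N ^ 2 - 3 * g ^ 2 := by nlinarith
      nlinarith
    have htg : g < t := by
      refine lt_of_le_of_ne ht1 ?_
      rintro rfl
      nlinarith
    have hgt : g ^ 2 < t * t := by nlinarith
    have ht0 : 0 < t := hg.trans_lt htg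
    refine ⟨t, ⟨⟨ht0, ht0, ht0⟩, hgt, hgt, hgt⟩, ?_⟩
    rw [invSigma_three]
    linarith
  · rintro l ⟨⟨⟨h0, h1, h2⟩, h01, h02, h12⟩, h3⟩ k ⟨⟨⟨k0, k1, k2⟩, k01, k02, k12⟩, k3⟩ a b ha hb hab
    simp only [Set.mem_ofPred_eq, invSigma_three] at h3 k3
    have m01 := sq_lt_mul_combo hg ha hb hab h0 h1 k0 k1 h01 k01
    refine ⟨⟨⟨add_pos_of_combo ha hb hab h0 k0, add_pos_of_combo ha hb hab h1 k1,
      add_pos_of_combo ha hb hab h2 k2⟩, m01,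
      sq_lt_mul_combo hg ha hb hab h0 h2 k0 k2 h02 k02,
      sq_lt_mul_combo hg ha hb hab h1 h2 k1 k2 h12 k12⟩, ?_⟩
    simp only [Set.mem_ofPred_eq, invSigma_three, Pi.add_apply, Pi.smul_apply, smul_eq_mul]
    -- Over the convex set `g² < x y`, positivity of the cubic is the strict epigraph condition for
    -- a convex graph.
    have e1 : (g ^ 2 * (l 0 + l 1) + c₀) / (l 0 * l 1 - g ^ 2) < l 2 := by
      rw [div_lt_iff₀ (by linarith)]; linarith
    have e2 : (g ^ 2 * (k 0 + k 1) + c₀) / (k 0 * k 1 - g ^ 2) < k 2 := by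
      rw [div_lt_iff₀ (by linarith)]; linarith
    have := (graph_convex hg h.le ha hb hab h0 h1 k0 k1 h01 k01).trans_lt
      (lt_combo ha hb hab e1 e2)
    rw [div_lt_iff₀ (by linarith)] at this
    linarith

end Regions

/-! ### The positivity region in degree four. -/

section QuarticRegion

open Function

theorem invSigma_four (c₀ c₁ c₂ : ℝ) (l : Fin 4 → ℝ) :
    invSigma ![c₀, c₁, c₂, 0] l = l 0 * l 1 * l 2 * l 3 -
      c₂ * (l 0 * l 1 + l 0 * l 2 + l 0 * l 3 + l 1 * l 2 + l 1 * l 3 + l 2 * l 3) -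
      c₁ * (l 0 + l 1 + l 2 + l 3) - c₀ := by
  have h : ∑ t ∈ Finset.powersetCard 2 (Finset.univ : Finset (Fin 4)), ∏ i ∈ t, l i =
      l 0 * l 1 + l 0 * l 2 + l 0 * l 3 + l 1 * l 2 + l 1 * l 3 + l 2 * l 3 := by
    have h' : Finset.powersetCard 2 (Finset.univ : Finset (Fin 4)) =
        {{0, 1}, {0, 2}, {0, 3}, {1, 2}, {1, 3}, {2, 3}} := by decide
    rw [h', Finset.sum_insert (by decide), Finset.sum_insert (by decide),
      Finset.sum_insert (by decide), Finset.sum_insert (by decide), Finset.sum_insert (by decide),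
      Finset.sum_singleton, Finset.prod_pair (by decide), Finset.prod_pair (by decide),
      Finset.prod_pair (by decide), Finset.prod_pair (by decide), Finset.prod_pair (by decide),
      Finset.prod_pair (by decide)]
    ring
  simp [invSigma, sigmaSymm, MvPolynomial.esymm, Fin.sum_univ_succ, Fin.prod_univ_succ,
    Finset.powersetCard_one, h]
  ring

theorem pairForm_four_zero_one (c₀ c₁ c₂ : ℝ) (l : Fin 4 → ℝ) :
    PairForm (invSigma ![c₀, c₁, c₂, 0]) 0 1 l (l 2 * l 3 - c₂) (-(c₂ * (l 2 + l 3) + c₁))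
      (-(c₂ * (l 2 * l 3) + c₁ * (l 2 + l 3) + c₀)) := by
  intro x y
  simp [invSigma_four]
  ring

theorem pairForm_four_zero_two (c₀ c₁ c₂ : ℝ) (l : Fin 4 → ℝ) :
    PairForm (invSigma ![c₀, c₁, c₂, 0]) 0 2 l (l 1 * l 3 - c₂) (-(c₂ * (l 1 + l 3) + c₁))
      (-(c₂ * (l 1 * l 3) + c₁ * (l 1 + l 3) + c₀)) := by
  intro x y
  simp [invSigma_four]
  ring

theorem pairForm_four_zero_three (c₀ c₁ c₂ : ℝ) (l : Fin 4 → ℝ) :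
    PairForm (invSigma ![c₀, c₁, c₂, 0]) 0 3 l (l 1 * l 2 - c₂) (-(c₂ * (l 1 + l 2) + c₁))
      (-(c₂ * (l 1 * l 2) + c₁ * (l 1 + l 2) + c₀)) := by
  intro x y
  simp [invSigma_four]
  ring

theorem pairForm_four_one_two (c₀ c₁ c₂ : ℝ) (l : Fin 4 → ℝ) :
    PairForm (invSigma ![c₀, c₁, c₂, 0]) 1 2 l (l 0 * l 3 - c₂) (-(c₂ * (l 0 + l 3) + c₁))
      (-(c₂ * (l 0 * l 3) + c₁ * (l 0 + l 3) + c₀)) := by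
  intro x y
  simp [invSigma_four]
  ring

theorem pairForm_four_one_three (c₀ c₁ c₂ : ℝ) (l : Fin 4 → ℝ) :
    PairForm (invSigma ![c₀, c₁, c₂, 0]) 1 3 l (l 0 * l 2 - c₂) (-(c₂ * (l 0 + l 2) + c₁))
      (-(c₂ * (l 0 * l 2) + c₁ * (l 0 + l 2) + c₀)) := by
  intro x y
  simp [invSigma_four]
  ring

theorem pairForm_four_two_three (c₀ c₁ c₂ : ℝ) (l : Fin 4 → ℝ) :
    PairForm (invSigma ![c₀, c₁, c₂, 0]) 2 3 l (l 0 * l 1 - c₂) (-(c₂ * (l 0 + l 1) + c₁))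
      (-(c₂ * (l 0 * l 1) + c₁ * (l 0 + l 1) + c₀)) := by
  intro x y
  simp [invSigma_four]
  ring

theorem exists_pairForm_four (c₀ c₁ c₂ : ℝ) (i j : Fin 4) (hij : i ≠ j) (l : Fin 4 → ℝ) :
    ∃ A B C, PairForm (invSigma ![c₀, c₁, c₂, 0]) i j l A B C := by
  fin_cases i <;> fin_cases j
  · exact absurd rfl hij
  · exact ⟨_, _, _, pairForm_four_zero_one c₀ c₁ c₂ l⟩
  · exact ⟨_, _, _, pairForm_four_zero_two c₀ c₁ c₂ l⟩
  · exact ⟨_, _, _, pairForm_four_zero_three c₀ c₁ c₂ l⟩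
  · exact ⟨_, _, _, (pairForm_four_zero_one c₀ c₁ c₂ l).swap (by decide)⟩
  · exact absurd rfl hij
  · exact ⟨_, _, _, pairForm_four_one_two c₀ c₁ c₂ l⟩
  · exact ⟨_, _, _, pairForm_four_one_three c₀ c₁ c₂ l⟩
  · exact ⟨_, _, _, (pairForm_four_zero_two c₀ c₁ c₂ l).swap (by decide)⟩
  · exact ⟨_, _, _, (pairForm_four_one_two c₀ c₁ c₂ l).swap (by decide)⟩
  · exact absurd rfl hij
  · exact ⟨_, _, _, pairForm_four_two_three c₀ c₁ c₂ l⟩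
  · exact ⟨_, _, _, (pairForm_four_zero_three c₀ c₁ c₂ l).swap (by decide)⟩
  · exact ⟨_, _, _, (pairForm_four_one_three c₀ c₁ c₂ l).swap (by decide)⟩
  · exact ⟨_, _, _, (pairForm_four_two_three c₀ c₁ c₂ l).swap (by decide)⟩
  · exact absurd rfl hij

/-- The region of `ℝ⁴` in which all partial derivatives of the quartic are positive. -/
def quarticRegion (g c₁ : ℝ) : Set (Fin 4 → ℝ) :=
  {l | ((0 < l 0 ∧ 0 < l 1) ∧ (0 < l 2 ∧ 0 < l 3)) ∧
    ((g ^ 2 < l 0 * l 1 ∧ g ^ 2 < l 2 * l 3) ∧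
      ((g ^ 2 < l 0 * l 2 ∧ g ^ 2 < l 0 * l 3) ∧ (g ^ 2 < l 1 * l 2 ∧ g ^ 2 < l 1 * l 3))) ∧
    ((g ^ 2 * (l 0 + l 1 + l 2) + c₁ < l 0 * l 1 * l 2 ∧
        g ^ 2 * (l 0 + l 1 + l 3) + c₁ < l 0 * l 1 * l 3) ∧
      (g ^ 2 * (l 0 + l 2 + l 3) + c₁ < l 0 * l 2 * l 3 ∧
        g ^ 2 * (l 1 + l 2 + l 3) + c₁ < l 1 * l 2 * l 3))}

theorem isOpen_quarticRegion (g c₁ : ℝ) : IsOpen (quarticRegion g c₁) := by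
  simp only [quarticRegion, Set.ofPred_and]
  repeat' apply IsOpen.inter
  all_goals exact isOpen_lt (by fun_prop) (by fun_prop)

theorem quarticRegion_swap {g c₁ : ℝ} {l : Fin 4 → ℝ} (hl : l ∈ quarticRegion g c₁) :
    ![l 2, l 3, l 0, l 1] ∈ quarticRegion g c₁ := by
  obtain ⟨⟨⟨h0, h1⟩, h2, h3⟩, ⟨⟨h01, h23⟩, ⟨h02, h03⟩, h12, h13⟩, ⟨d3, d2⟩, d1, d0⟩ := hl
  refine ⟨⟨⟨h2, h3⟩, h0, h1⟩, ⟨⟨h23, h01⟩, ⟨?_, ?_⟩, ?_, ?_⟩, ⟨?_, ?_⟩, ?_, ?_⟩ <;>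
    simp <;> linarith

/-- In the Taylor expansion at `l` every coefficient of a monomial in `s` is positive. The linear
term in `s 3` is kept because it yields strict growth. -/
theorem invSigma_four_lt_of_le {g c₀ c₁ : ℝ} {l : Fin 4 → ℝ} (hl : l ∈ quarticRegion g c₁)
    {s : Fin 4 → ℝ} (hs : ∀ i, 0 ≤ s i) :
    invSigma ![c₀, c₁, g ^ 2, 0] l + (l 0 * l 1 * l 2 - (g ^ 2 * (l 0 + l 1 + l 2) + c₁)) * s 3 ≤
      invSigma ![c₀, c₁, g ^ 2, 0] (fun i => l i + s i) := by
  obtain ⟨⟨⟨h0, h1⟩, h2, h3⟩, ⟨⟨h01, h23⟩, ⟨h02, h03⟩, h12, h13⟩, ⟨d3, d2⟩, d1, d0⟩ := hl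
  simp only [invSigma_four]
  have s0 := hs 0
  have s1 := hs 1
  have s2 := hs 2
  have s3 := hs 3
  rw [← sub_pos] at h01 h23 h02 h03 h12 h13 d3 d2 d1 d0
  have e : 0 ≤ (l 1 * l 2 * l 3 - (g ^ 2 * (l 1 + l 2 + l 3) + c₁)) * s 0 +
      (l 0 * l 2 * l 3 - (g ^ 2 * (l 0 + l 2 + l 3) + c₁)) * s 1 +
      (l 0 * l 1 * l 3 - (g ^ 2 * (l 0 + l 1 + l 3) + c₁)) * s 2 +
      (l 0 * l 1 - g ^ 2) * (s 2 * s 3) + (l 2 * l 3 - g ^ 2) * (s 0 * s 1) +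
      (l 0 * l 2 - g ^ 2) * (s 1 * s 3) + (l 0 * l 3 - g ^ 2) * (s 1 * s 2) +
      (l 1 * l 2 - g ^ 2) * (s 0 * s 3) + (l 1 * l 3 - g ^ 2) * (s 0 * s 2) +
      l 0 * (s 1 * s 2 * s 3) + l 1 * (s 0 * s 2 * s 3) + l 2 * (s 0 * s 1 * s 3) +
      l 3 * (s 0 * s 1 * s 2) + s 0 * s 1 * s 2 * s 3 := by positivity
  linarith

theorem le_of_mem_closure {X : Type*} [TopologicalSpace X] {P : Set X} {f g : X → ℝ}
    (hf : Continuous f) (hg : Continuous g) (h : ∀ l ∈ P, f l < g l) {l : X} (hl : l ∈ closure P) :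
    f l ≤ g l :=
  closure_minimal (fun k hk => (h k hk).le) (isClosed_le hf hg) hl

/-- Source of the threshold on `c₀`: where the derivative in `d` vanishes, the quartic no longer
depends on `d`, and `sigma_bound_on_cubic` makes it at most `-(3 g² x² + 3 c₁ x + c₀) < 0`. -/
theorem cubic_strict_of_border {g x c₀ c₁ a b c d : ℝ} (hg : 0 ≤ g) (hx : g ≤ x)
    (hc₁ : c₁ = x ^ 3 - 3 * g ^ 2 * x) (hc₀ : -3 * g ^ 2 * x ^ 2 - 3 * c₁ * x < c₀)
    (ha : 0 ≤ a) (hb : 0 ≤ b) (hc : 0 ≤ c) (hab : g ^ 2 ≤ a * b) (hac : g ^ 2 ≤ a * c)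
    (hbc : g ^ 2 ≤ b * c) (hD : g ^ 2 * (a + b + c) + c₁ ≤ a * b * c)
    (hf : 0 ≤ (a * b * c - (g ^ 2 * (a + b + c) + c₁)) * d -
        (g ^ 2 * (a * b + a * c + b * c) + c₁ * (a + b + c) + c₀)) :
    g ^ 2 * (a + b + c) + c₁ < a * b * c := by
  refine lt_of_le_of_ne hD fun heq => ?_
  have := sigma_bound_on_cubic hg hx hc₁ ha hb hc hab hac hbc (by linarith)
  rw [← heq, sub_self, zero_mul] at hf
  linarith

/-- If `a b = g²`, the terms in `c` cancel in `hD`, leaving `g² (a + b) + c₁ < 0`, against `a + b ≥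
2 g`. -/
theorem sq_lt_mul_of_border {g c₁ a b c : ℝ} (hlow : -2 * g ^ 3 ≤ c₁)
    (ha : 0 ≤ a) (hb : 0 ≤ b) (hab : g ^ 2 ≤ a * b)
    (hD : g ^ 2 * (a + b + c) + c₁ < a * b * c) : g ^ 2 < a * b := by
  refine lt_of_le_of_ne hab fun heq => ?_
  have hs : 2 * g ≤ a + b := by
    have := abs_le_of_sq_le_sq' (show (2 * g) ^ 2 ≤ (a + b) ^ 2 by nlinarith [sq_nonneg (a - b)])
      (by positivity)
    exact this.2
  have h1 := mul_le_mul_of_nonneg_left hs (sq_nonneg g)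
  have h2 : g ^ 2 * (2 * g) = 2 * g ^ 3 := by ring
  rw [← heq] at hD
  linarith

theorem mem_quarticRegion_of_mem_closure {g x c₀ c₁ : ℝ} (hg : 0 ≤ g) (hx : g ≤ x)
    (hc₁ : c₁ = x ^ 3 - 3 * g ^ 2 * x) (hc₀ : -3 * g ^ 2 * x ^ 2 - 3 * c₁ * x < c₀)
    {l : Fin 4 → ℝ} (hl : l ∈ closure (quarticRegion g c₁))
    (h0 : 0 ≤ invSigma ![c₀, c₁, g ^ 2, 0] l) : l ∈ quarticRegion g c₁ := by
  have hlow : -2 * g ^ 3 ≤ c₁ := hc₁ ▸ neg_two_mul_cube_le hg hx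
  have hg2 := sq_nonneg g
  have a0 := nonneg_of_mem_closure (g := fun l => l 0) (by fun_prop) (fun k hk => hk.1.1.1) hl
  have a1 := nonneg_of_mem_closure (g := fun l => l 1) (by fun_prop) (fun k hk => hk.1.1.2) hl
  have a2 := nonneg_of_mem_closure (g := fun l => l 2) (by fun_prop) (fun k hk => hk.1.2.1) hl
  have a3 := nonneg_of_mem_closure (g := fun l => l 3) (by fun_prop) (fun k hk => hk.1.2.2) hl
  have b01 : g ^ 2 ≤ l 0 * l 1 := le_of_mem_closure (f := fun _ => g ^ 2)
    (g := fun l => l 0 * l 1) (by fun_prop) (by fun_prop) (fun k hk => hk.2.1.1.1) hl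
  have b23 : g ^ 2 ≤ l 2 * l 3 := le_of_mem_closure (f := fun _ => g ^ 2)
    (g := fun l => l 2 * l 3) (by fun_prop) (by fun_prop) (fun k hk => hk.2.1.1.2) hl
  have b02 : g ^ 2 ≤ l 0 * l 2 := le_of_mem_closure (f := fun _ => g ^ 2)
    (g := fun l => l 0 * l 2) (by fun_prop) (by fun_prop) (fun k hk => hk.2.1.2.1.1) hl
  have b03 : g ^ 2 ≤ l 0 * l 3 := le_of_mem_closure (f := fun _ => g ^ 2)
    (g := fun l => l 0 * l 3) (by fun_prop) (by fun_prop) (fun k hk => hk.2.1.2.1.2) hl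
  have b12 : g ^ 2 ≤ l 1 * l 2 := le_of_mem_closure (f := fun _ => g ^ 2)
    (g := fun l => l 1 * l 2) (by fun_prop) (by fun_prop) (fun k hk => hk.2.1.2.2.1) hl
  have b13 : g ^ 2 ≤ l 1 * l 3 := le_of_mem_closure (f := fun _ => g ^ 2)
    (g := fun l => l 1 * l 3) (by fun_prop) (by fun_prop) (fun k hk => hk.2.1.2.2.2) hl
  have d3 : g ^ 2 * (l 0 + l 1 + l 2) + c₁ ≤ l 0 * l 1 * l 2 := le_of_mem_closure
    (f := fun l => g ^ 2 * (l 0 + l 1 + l 2) + c₁) (g := fun l => l 0 * l 1 * l 2)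
    (by fun_prop) (by fun_prop) (fun k hk => hk.2.2.1.1) hl
  have d2 : g ^ 2 * (l 0 + l 1 + l 3) + c₁ ≤ l 0 * l 1 * l 3 := le_of_mem_closure
    (f := fun l => g ^ 2 * (l 0 + l 1 + l 3) + c₁) (g := fun l => l 0 * l 1 * l 3)
    (by fun_prop) (by fun_prop) (fun k hk => hk.2.2.1.2) hl
  have d1 : g ^ 2 * (l 0 + l 2 + l 3) + c₁ ≤ l 0 * l 2 * l 3 := le_of_mem_closure
    (f := fun l => g ^ 2 * (l 0 + l 2 + l 3) + c₁) (g := fun l => l 0 * l 2 * l 3)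
    (by fun_prop) (by fun_prop) (fun k hk => hk.2.2.2.1) hl
  have d0 : g ^ 2 * (l 1 + l 2 + l 3) + c₁ ≤ l 1 * l 2 * l 3 := le_of_mem_closure
    (f := fun l => g ^ 2 * (l 1 + l 2 + l 3) + c₁) (g := fun l => l 1 * l 2 * l 3)
    (by fun_prop) (by fun_prop) (fun k hk => hk.2.2.2.2) hl
  rw [invSigma_four] at h0
  have D3 := cubic_strict_of_border hg hx hc₁ hc₀ (d := l 3) a0 a1 a2 b01 b02 b12 d3 (by linarith)
  have D2 := cubic_strict_of_border hg hx hc₁ hc₀ (d := l 2) a0 a1 a3 b01 b03 b13 d2 (by linarith)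
  have D1 := cubic_strict_of_border hg hx hc₁ hc₀ (d := l 1) a0 a2 a3 b02 b03 b23 d1 (by linarith)
  have D0 := cubic_strict_of_border hg hx hc₁ hc₀ (d := l 0) a1 a2 a3 b12 b13 b23 d0 (by linarith)
  have B01 := sq_lt_mul_of_border hlow a0 a1 b01 D3
  have B23 := sq_lt_mul_of_border (c := l 0) hlow a2 a3 b23 (by linarith)
  have B02 := sq_lt_mul_of_border (c := l 1) hlow a0 a2 b02 (by linarith)
  have B03 := sq_lt_mul_of_border (c := l 1) hlow a0 a3 b03 (by linarith)
  have B12 := sq_lt_mul_of_border (c := l 0) hlow a1 a2 b12 (by linarith)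
  have B13 := sq_lt_mul_of_border (c := l 0) hlow a1 a3 b13 (by linarith)
  exact ⟨⟨⟨pos_of_mul_pos_left (hg2.trans_lt B01) a1, pos_of_mul_pos_right (hg2.trans_lt B01) a0⟩,
    pos_of_mul_pos_left (hg2.trans_lt B23) a3, pos_of_mul_pos_right (hg2.trans_lt B23) a2⟩,
    ⟨⟨B01, B23⟩, ⟨B02, B03⟩, B12, B13⟩, ⟨D3, D2⟩, D1, D0⟩

/-- If the partial derivatives `F` and the mixed second derivatives `a` have consistent signs, then
they are all negative or all positive. -/
theorem sign_dichotomy {a₀₁ a₀₂ a₀₃ a₁₂ a₁₃ a₂₃ F₀ F₁ F₂ F₃ : ℝ} (h01 : 0 < a₀₁ * F₁)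
    (h10 : 0 < a₀₁ * F₀) (h02 : 0 < a₀₂ * F₂) (h20 : 0 < a₀₂ * F₀) (h03 : 0 < a₀₃ * F₃)
    (h30 : 0 < a₀₃ * F₀) (h12 : 0 < a₁₂ * F₂) (h13 : 0 < a₁₃ * F₃) (h23 : 0 < a₂₃ * F₃) :
    ((a₀₁ < 0 ∧ a₂₃ < 0) ∧ ((a₀₂ < 0 ∧ a₀₃ < 0) ∧ (a₁₂ < 0 ∧ a₁₃ < 0))) ∨
    ((0 < a₀₁ ∧ 0 < a₂₃) ∧ ((0 < a₀₂ ∧ 0 < a₀₃) ∧ (0 < a₁₂ ∧ 0 < a₁₃))) ∧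
      ((0 < F₃ ∧ 0 < F₂) ∧ (0 < F₁ ∧ 0 < F₀)) := by
  by_cases h : F₀ < 0
  · left
    have e1 := neg_of_mul_pos_left h10 h.le
    have e2 := neg_of_mul_pos_left h20 h.le
    have e3 := neg_of_mul_pos_left h30 h.le
    have e4 := neg_of_mul_pos_right h02 e2.le
    have e5 := neg_of_mul_pos_right h03 e3.le
    exact ⟨⟨e1, neg_of_mul_pos_left h23 e5.le⟩, ⟨e2, e3⟩, neg_of_mul_pos_left h12 e4.le,
      neg_of_mul_pos_left h13 e5.le⟩
  · right
    have h := not_lt.1 h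
    have e1 := pos_of_mul_pos_left h10 h
    have e2 := pos_of_mul_pos_left h20 h
    have e3 := pos_of_mul_pos_left h30 h
    have e4 := pos_of_mul_pos_right h02 e2.le
    have e5 := pos_of_mul_pos_right h03 e3.le
    exact ⟨⟨⟨e1, pos_of_mul_pos_left h23 e5.le⟩, ⟨e2, e3⟩, pos_of_mul_pos_left h12 e4.le,
      pos_of_mul_pos_left h13 e5.le⟩, ⟨e5, e4⟩, pos_of_mul_pos_right h01 e1.le,
      pos_of_mul_pos_right h10 e1.le⟩

/-- In the negative case of `sign_dichotomy`, sliding in coordinates `1` and `2` keeps `l 0 * l 3 <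
g²`, hence keeps the case, while `l 1` grows; so `l 0 ≤ 0`. Sliding in coordinates `0` and `1` keeps
`l 2 * l 3` and makes `l 0` positive, a contradiction. -/
theorem levelSet_subset_quarticRegion {g c₀ c₁ : ℝ} {L : Set (Fin 4 → ℝ)}
    (hL : IsLevelSetOf (invSigma ![c₀, c₁, g ^ 2, 0]) L) : L ⊆ quarticRegion g c₁ := by
  have hsign := fun l (hl : l ∈ L) => sign_dichotomy
    (a₀₁ := l 2 * l 3 - g ^ 2) (a₀₂ := l 1 * l 3 - g ^ 2) (a₀₃ := l 1 * l 2 - g ^ 2)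
    (a₁₂ := l 0 * l 3 - g ^ 2) (a₁₃ := l 0 * l 2 - g ^ 2) (a₂₃ := l 0 * l 1 - g ^ 2)
    (F₀ := l 1 * l 2 * l 3 - (g ^ 2 * (l 1 + l 2 + l 3) + c₁))
    (F₁ := l 0 * l 2 * l 3 - (g ^ 2 * (l 0 + l 2 + l 3) + c₁))
    (F₂ := l 0 * l 1 * l 3 - (g ^ 2 * (l 0 + l 1 + l 3) + c₁))
    (F₃ := l 0 * l 1 * l 2 - (g ^ 2 * (l 0 + l 1 + l 2) + c₁))
    (by have := hL.mul_pos (by decide) hl (pairForm_four_zero_one c₀ c₁ (g ^ 2) l); linarith)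
    (by
      have := hL.mul_pos (by decide) hl ((pairForm_four_zero_one c₀ c₁ (g ^ 2) l).swap (by decide))
      linarith)
    (by have := hL.mul_pos (by decide) hl (pairForm_four_zero_two c₀ c₁ (g ^ 2) l); linarith)
    (by
      have := hL.mul_pos (by decide) hl ((pairForm_four_zero_two c₀ c₁ (g ^ 2) l).swap (by decide))
      linarith)
    (by have := hL.mul_pos (by decide) hl (pairForm_four_zero_three c₀ c₁ (g ^ 2) l); linarith)
    (by
      have := hL.mul_pos (by decide) hl
        ((pairForm_four_zero_three c₀ c₁ (g ^ 2) l).swap (by decide))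
      linarith)
    (by have := hL.mul_pos (by decide) hl (pairForm_four_one_two c₀ c₁ (g ^ 2) l); linarith)
    (by have := hL.mul_pos (by decide) hl (pairForm_four_one_three c₀ c₁ (g ^ 2) l); linarith)
    (by have := hL.mul_pos (by decide) hl (pairForm_four_two_three c₀ c₁ (g ^ 2) l); linarith)
  have hneg : ∀ l ∈ L, l 2 * l 3 - g ^ 2 < 0 → l 0 ≤ 0 := by
    intro l hl h
    refine nonpos_of_large_mul_lt (c := g ^ 2) fun M => ?_
    obtain ⟨x, y, hx, hxy⟩ := hL.exists_large (by decide) hl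
      (pairForm_four_one_two c₀ c₁ (g ^ 2) l) M
    refine ⟨x, hx, ?_⟩
    have h03 : l 0 * l 3 - g ^ 2 < 0 := by
      rcases hsign l hl with h' | h'
      · exact h'.2.2.1
      · exact absurd h'.1.1.1 h.not_gt
    rcases hsign _ hxy with h' | h'
    · have := h'.2.1.2
      have := h'.1.2
      simp at this
      linarith
    · have := h'.1.2.2.1
      simp at this
      linarith
  intro l hl
  rcases hsign l hl with h | ⟨h, hF⟩
  · exfalso
    obtain ⟨x, y, hx, hxy⟩ := hL.exists_large (by decide) hl
      (pairForm_four_zero_one c₀ c₁ (g ^ 2) l) 0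
    have := hneg _ hxy (by simpa using h.1.1)
    simp at this
    linarith
  have hpos : ∀ y : ℝ, (∃ x, 0 < x ∧ 0 < x * y - g ^ 2) → 0 < y := by
    rintro y ⟨x, hx, hxy⟩
    exact pos_of_mul_pos_right (a := x) (by nlinarith [sq_nonneg g]) hx.le
  have h1 : 0 < l 1 := by
    obtain ⟨x, y, hx, hxy⟩ := hL.exists_large (by decide) hl
      (pairForm_four_zero_two c₀ c₁ (g ^ 2) l) 0
    refine hpos _ ⟨x, hx, ?_⟩
    rcases hsign _ hxy with h' | h'
    · have := h'.2.1.1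
      simp at this
      linarith [h.2.1.1]
    · simpa using h'.1.1.2
  have h2 := hpos (l 2) ⟨l 1, h1, h.2.1.2⟩
  have h3 := hpos (l 3) ⟨l 1, h1, h.2.1.1⟩
  have h0 := hpos (l 0) ⟨l 1, h1, by linarith [h.1.2]⟩
  obtain ⟨⟨e01, e23⟩, ⟨e02, e03⟩, e12, e13⟩ := h
  obtain ⟨⟨d3, d2⟩, d1, d0⟩ := hF
  exact ⟨⟨⟨h0, h1⟩, h2, h3⟩, ⟨⟨sub_pos.1 e23, sub_pos.1 e01⟩, ⟨sub_pos.1 e13, sub_pos.1 e12⟩,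
    sub_pos.1 e03, sub_pos.1 e02⟩, ⟨sub_pos.1 d3, sub_pos.1 d2⟩, sub_pos.1 d1, sub_pos.1 d0⟩

end QuarticRegion

/-! ### Reduction to the vertices of the coordinate hyperbolas. -/

section QuarticConvexity

theorem vec_four_eta (l : Fin 4 → ℝ) : ![l 0, l 1, l 2, l 3] = l := by
  funext i
  fin_cases i <;> rfl

theorem invSigma_four_vec (c₀ c₁ c₂ x y z w : ℝ) :
    invSigma ![c₀, c₁, c₂, 0] ![x, y, z, w] = x * y * z * w -
      c₂ * (x * y + x * z + x * w + y * z + y * w + z * w) - c₁ * (x + y + z + w) - c₀ := by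
  rw [invSigma_four]; simp

theorem invSigma_four_swap (c₀ c₁ c₂ x y z w : ℝ) :
    invSigma ![c₀, c₁, c₂, 0] ![x, y, z, w] = invSigma ![c₀, c₁, c₂, 0] ![z, w, x, y] := by
  simp only [invSigma_four_vec]; ring

/-- The centre of the hyperbola in the plane of the last two coordinates. -/
noncomputable def hyperbolaCentre (g c₁ x y : ℝ) : ℝ := (g ^ 2 * (x + y) + c₁) / (x * y - g ^ 2)

theorem hyperbolaCentre_mul {g c₁ x y : ℝ} (h : g ^ 2 < x * y) :
    hyperbolaCentre g c₁ x y * (x * y - g ^ 2) = g ^ 2 * (x + y) + c₁ :=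
  div_mul_cancel₀ _ (sub_pos.2 h).ne'

theorem invSigma_four_shift {g c₀ c₁ c x y : ℝ} (p q : ℝ)
    (hc : c * (x * y - g ^ 2) = g ^ 2 * (x + y) + c₁) :
    invSigma ![c₀, c₁, g ^ 2, 0] ![x, y, c + p, c + q] = (x * y - g ^ 2) * (p * q) -
      ((x * y - g ^ 2) * c ^ 2 + g ^ 2 * (x * y) + c₁ * (x + y) + c₀) := by
  rw [invSigma_four_vec]
  linear_combination (2 * c + p + q) * hc

theorem hyperbolaCentre_lt {g c₁ : ℝ} {l : Fin 4 → ℝ} (hl : l ∈ quarticRegion g c₁) :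
    hyperbolaCentre g c₁ (l 0) (l 1) < l 2 ∧ hyperbolaCentre g c₁ (l 0) (l 1) < l 3 := by
  have h01 := sub_pos.2 hl.2.1.1.1
  constructor
  · rw [hyperbolaCentre, div_lt_iff₀ h01]
    linarith [hl.2.2.1.1]
  · rw [hyperbolaCentre, div_lt_iff₀ h01]
    linarith [hl.2.2.1.2]

/-- The common value of the last two coordinates at the vertex of the hyperbola. -/
noncomputable def hyperbolaVertex (g c₁ : ℝ) (l : Fin 4 → ℝ) : ℝ :=
  hyperbolaCentre g c₁ (l 0) (l 1) + √((l 2 - hyperbolaCentre g c₁ (l 0) (l 1)) *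
    (l 3 - hyperbolaCentre g c₁ (l 0) (l 1)))

/-- Moving along the hyperbola to its vertex stays in the region. -/
theorem vertex_mem_quarticRegion {g r c₀ c₁ : ℝ} (hg : 0 ≤ g) (hr : g ≤ r)
    (hc₁ : c₁ = r ^ 3 - 3 * g ^ 2 * r) (hc₀ : -3 * g ^ 2 * r ^ 2 - 3 * c₁ * r < c₀)
    {l : Fin 4 → ℝ} (hl : l ∈ quarticRegion g c₁)
    (h0 : 0 < invSigma ![c₀, c₁, g ^ 2, 0] l) :
    ![l 0, l 1, hyperbolaVertex g c₁ l, hyperbolaVertex g c₁ l] ∈ quarticRegion g c₁ ∧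
      0 < invSigma ![c₀, c₁, g ^ 2, 0]
        ![l 0, l 1, hyperbolaVertex g c₁ l, hyperbolaVertex g c₁ l] := by
  obtain ⟨hz, hw⟩ := hyperbolaCentre_lt hl
  have hc := hyperbolaCentre_mul (c₁ := c₁) hl.2.1.1.1
  unfold hyperbolaVertex
  set c := hyperbolaCentre g c₁ (l 0) (l 1)
  have hu := sub_pos.2 hz
  have hv := sub_pos.2 hw
  have hl' : ![l 0, l 1, c + (l 2 - c), c + (l 3 - c)] = l := by
    simp only [add_sub_cancel]; exact vec_four_eta l
  have hconst : ∀ s : ℝ, 0 < s → invSigma ![c₀, c₁, g ^ 2, 0]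
      ![l 0, l 1, c + (l 2 - c) * s, c + (l 3 - c) / s] = invSigma ![c₀, c₁, g ^ 2, 0] l := by
    intro s hs
    conv_rhs => rw [← hl']
    rw [invSigma_four_shift _ _ hc, invSigma_four_shift _ _ hc]
    field_simp
  have hcont : ContinuousOn (fun s : ℝ => ![l 0, l 1, c + (l 2 - c) * s, c + (l 3 - c) / s])
      (Set.Ioi 0) := by
    refine continuousOn_pi.2 fun i => ?_
    fin_cases i
    · exact continuousOn_const
    · exact continuousOn_const
    · exact (by fun_prop : Continuous fun s : ℝ => c + (l 2 - c) * s).continuousOn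
    · exact continuousOn_const.add (continuousOn_const.div continuousOn_id fun t ht => ne_of_gt ht)
  -- `f` is constant and positive on this branch, so the branch cannot cross the boundary of the
  -- region.
  have hsub := (isPreconnected_Ioi.image _ hcont).subset_of_closure_inter_subset
    (isOpen_quarticRegion g c₁)
    ⟨l, ⟨1, by simp, by simpa using vec_four_eta l⟩, hl⟩
    (by
      rintro k ⟨hk, ⟨s, hs, rfl⟩⟩
      exact mem_quarticRegion_of_mem_closure hg hr hc₁ hc₀ hk ((hconst s hs).symm ▸ h0.le))
  have hsu := Real.sqrt_pos.2 hu
  have hsv := Real.sqrt_pos.2 hv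
  have e1 : (l 2 - c) * (√(l 3 - c) / √(l 2 - c)) = √((l 2 - c) * (l 3 - c)) := by
    rw [Real.sqrt_mul hu.le]
    nth_rewrite 1 [← Real.mul_self_sqrt hu.le]
    field_simp
  have e2 : (l 3 - c) / (√(l 3 - c) / √(l 2 - c)) = √((l 2 - c) * (l 3 - c)) := by
    rw [Real.sqrt_mul hu.le]
    nth_rewrite 1 [← Real.mul_self_sqrt hv.le]
    field_simp
  have hs : 0 < √(l 3 - c) / √(l 2 - c) := div_pos hsv hsu
  have hmem := hsub (Set.mem_image_of_mem _ (Set.mem_Ioi.2 hs))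
  have hval := hconst _ hs
  simp only [e1, e2] at hmem hval
  exact ⟨hmem, hval ▸ h0⟩

/-- Convexity transfers from the vertices of the hyperbolas to the hyperbolas. -/
theorem invSigma_four_combo_pos {g c₀ c₁ : ℝ} (hg : 0 ≤ g) (hlow : -2 * g ^ 3 ≤ c₁)
    {l k : Fin 4 → ℝ} (hl : l ∈ quarticRegion g c₁) (hk : k ∈ quarticRegion g c₁) {a b : ℝ}
    (ha : 0 ≤ a) (hb : 0 ≤ b) (hab : a + b = 1)
    (h : 0 < invSigma ![c₀, c₁, g ^ 2, 0] ![a * l 0 + b * k 0, a * l 1 + b * k 1,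
      a * hyperbolaVertex g c₁ l + b * hyperbolaVertex g c₁ k,
      a * hyperbolaVertex g c₁ l + b * hyperbolaVertex g c₁ k]) :
    0 < invSigma ![c₀, c₁, g ^ 2, 0] ![a * l 0 + b * k 0, a * l 1 + b * k 1,
      a * l 2 + b * k 2, a * l 3 + b * k 3] := by
  have hxy := sq_lt_mul_combo hg ha hb hab hl.1.1.1 hl.1.1.2 hk.1.1.1 hk.1.1.2 hl.2.1.1.1 hk.2.1.1.1
  have hconv := graph_convex hg hlow ha hb hab hl.1.1.1 hl.1.1.2 hk.1.1.1 hk.1.1.2 hl.2.1.1.1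
    hk.2.1.1.1
  obtain ⟨hz, hw⟩ := hyperbolaCentre_lt hl
  obtain ⟨hz', hw'⟩ := hyperbolaCentre_lt hk
  have hc := hyperbolaCentre_mul (c₁ := c₁) hxy
  unfold hyperbolaVertex at h
  change hyperbolaCentre g c₁ _ _ ≤
    a * hyperbolaCentre g c₁ _ _ + b * hyperbolaCentre g c₁ _ _ at hconv
  set C := hyperbolaCentre g c₁ (a * l 0 + b * k 0) (a * l 1 + b * k 1)
  set c := hyperbolaCentre g c₁ (l 0) (l 1)
  set d := hyperbolaCentre g c₁ (k 0) (k 1)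
  -- The slack is `a c + b d - C`, nonnegative by convexity of the centre: measured from `C`, both
  -- combined coordinates exceed the combined offsets by it.
  have key := sq_add_sqrt_mul_le ha hb (sub_pos.2 hz).le (sub_pos.2 hw).le (sub_pos.2 hz').le
    (sub_pos.2 hw').le (sub_nonneg.2 hconv)
  generalize √((l 2 - c) * (l 3 - c)) = S at h key
  generalize √((k 2 - d) * (k 3 - d)) = T at h key
  have e : a * (c + S) + b * (d + T) = C + (a * S + b * T + (a * c + b * d - C)) := by ring
  have e2 : a * l 2 + b * k 2 = C + (a * (l 2 - c) + b * (k 2 - d) + (a * c + b * d - C)) := by ring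
  have e3 : a * l 3 + b * k 3 = C + (a * (l 3 - c) + b * (k 3 - d) + (a * c + b * d - C)) := by ring
  rw [e, invSigma_four_shift _ _ hc] at h
  rw [e2, e3, invSigma_four_shift _ _ hc]
  have := mul_le_mul_of_nonneg_left key (sub_pos.2 hxy).le
  nlinarith

theorem cubic_combo {g c₁ a b x₁ y₁ z₁ x₂ y₂ z₂ : ℝ} (hg : 0 ≤ g) (hlow : -2 * g ^ 3 ≤ c₁)
    (ha : 0 ≤ a) (hb : 0 ≤ b) (hab : a + b = 1) (hx₁ : 0 < x₁) (hy₁ : 0 < y₁) (hx₂ : 0 < x₂)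
    (hy₂ : 0 < y₂) (h₁ : g ^ 2 < x₁ * y₁) (h₂ : g ^ 2 < x₂ * y₂)
    (hD₁ : g ^ 2 * (x₁ + y₁ + z₁) + c₁ < x₁ * y₁ * z₁)
    (hD₂ : g ^ 2 * (x₂ + y₂ + z₂) + c₁ < x₂ * y₂ * z₂) :
    g ^ 2 * ((a * x₁ + b * x₂) + (a * y₁ + b * y₂) + (a * z₁ + b * z₂)) + c₁ <
      (a * x₁ + b * x₂) * (a * y₁ + b * y₂) * (a * z₁ + b * z₂) := by
  have hxy := sq_lt_mul_combo hg ha hb hab hx₁ hy₁ hx₂ hy₂ h₁ h₂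
  have e1 : (g ^ 2 * (x₁ + y₁) + c₁) / (x₁ * y₁ - g ^ 2) < z₁ := by
    rw [div_lt_iff₀ (sub_pos.2 h₁)]; linarith
  have e2 : (g ^ 2 * (x₂ + y₂) + c₁) / (x₂ * y₂ - g ^ 2) < z₂ := by
    rw [div_lt_iff₀ (sub_pos.2 h₂)]; linarith
  have := (graph_convex hg hlow ha hb hab hx₁ hy₁ hx₂ hy₂ h₁ h₂).trans_lt (lt_combo ha hb hab e1 e2)
  rw [div_lt_iff₀ (sub_pos.2 hxy)] at this
  linarith

theorem convex_quarticRegion {g c₁ : ℝ} (hg : 0 ≤ g) (hlow : -2 * g ^ 3 ≤ c₁) :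
    Convex ℝ (quarticRegion g c₁) := by
  rintro l ⟨⟨⟨l0, l1⟩, l2, l3⟩, ⟨⟨l01, l23⟩, ⟨l02, l03⟩, l12, l13⟩, ⟨ld3, ld2⟩, ld1, ld0⟩
    k ⟨⟨⟨k0, k1⟩, k2, k3⟩, ⟨⟨k01, k23⟩, ⟨k02, k03⟩, k12, k13⟩, ⟨kd3, kd2⟩, kd1, kd0⟩ a b ha hb hab
  have hp : ∀ {u v : ℝ}, 0 < u → 0 < v → 0 < a * u + b * v := add_pos_of_combo ha hb hab
  exact ⟨⟨⟨hp l0 k0, hp l1 k1⟩, hp l2 k2,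
      hp l3 k3⟩,
    ⟨⟨sq_lt_mul_combo hg ha hb hab l0 l1 k0 k1 l01 k01,
      sq_lt_mul_combo hg ha hb hab l2 l3 k2 k3 l23 k23⟩,
    ⟨sq_lt_mul_combo hg ha hb hab l0 l2 k0 k2 l02 k02,
      sq_lt_mul_combo hg ha hb hab l0 l3 k0 k3 l03 k03⟩,
    sq_lt_mul_combo hg ha hb hab l1 l2 k1 k2 l12 k12,
    sq_lt_mul_combo hg ha hb hab l1 l3 k1 k3 l13 k13⟩,
    ⟨cubic_combo hg hlow ha hb hab l0 l1 k0 k1 l01 k01 ld3 kd3,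
      cubic_combo hg hlow ha hb hab l0 l1 k0 k1 l01 k01 ld2 kd2⟩,
    cubic_combo hg hlow ha hb hab l0 l2 k0 k2 l02 k02 ld1 kd1,
    cubic_combo hg hlow ha hb hab l1 l2 k1 k2 l12 k12 ld0 kd0⟩

end QuarticConvexity

/-! ### Convexity of the plane section and the level set in degree four. -/

section QuarticLevelSet

theorem lt_of_cubic_pos {g r m : ℝ} (hg : 0 ≤ g) (hr : g ≤ r) (hm : g ≤ m)
    (h : r ^ 3 - 3 * g ^ 2 * r < m ^ 3 - 3 * g ^ 2 * m) : r < m := by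
  by_contra hc
  rw [not_lt] at hc
  have e : r ^ 3 - 3 * g ^ 2 * r - (m ^ 3 - 3 * g ^ 2 * m) =
      (r - m) * (r ^ 2 + r * m + m ^ 2 - 3 * g ^ 2) := by ring
  have h1 : 0 ≤ r ^ 2 + r * m + m ^ 2 - 3 * g ^ 2 := by nlinarith
  have := mul_nonneg (sub_nonneg.2 hc) h1
  linarith

theorem cubic_lt_of_lt {g r m : ℝ} (hg : 0 ≤ g) (hr : g ≤ r) (hm : r < m) :
    r ^ 3 - 3 * g ^ 2 * r < m ^ 3 - 3 * g ^ 2 * m := by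
  have e : m ^ 3 - 3 * g ^ 2 * m - (r ^ 3 - 3 * g ^ 2 * r) =
      (m - r) * (r ^ 2 + r * m + m ^ 2 - 3 * g ^ 2) := by ring
  have h1 : 0 < r ^ 2 + r * m + m ^ 2 - 3 * g ^ 2 := by nlinarith
  have := mul_pos (sub_pos.2 hm) h1
  linarith

theorem diag_mem_quarticRegion {g r c₁ m : ℝ} (hg : 0 ≤ g) (hr : g ≤ r)
    (hc₁ : c₁ = r ^ 3 - 3 * g ^ 2 * r) (hm : r < m) : (fun _ => m) ∈ quarticRegion g c₁ := by
  have h0 : 0 < m := (hg.trans hr).trans_lt hm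
  have h1 : g ^ 2 < m * m := by nlinarith
  have h2 : g ^ 2 * (m + m + m) + c₁ < m * m * m := by
    have := cubic_lt_of_lt hg hr hm
    linarith
  exact ⟨⟨⟨h0, h0⟩, h0, h0⟩, ⟨⟨h1, h1⟩, ⟨h1, h1⟩, h1, h1⟩, ⟨h2, h2⟩, h2, h2⟩

theorem invSigma_four_strictMono {g c₀ c₁ : ℝ} {l : Fin 4 → ℝ} (hl : l ∈ quarticRegion g c₁)
    {s : ℝ} (hs : 0 < s) :
    invSigma ![c₀, c₁, g ^ 2, 0] l < invSigma ![c₀, c₁, g ^ 2, 0] (fun i => l i + s) := by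
  have h := invSigma_four_lt_of_le (c₀ := c₀) hl (s := fun _ => s) fun _ => hs.le
  have := mul_pos (sub_pos.2 hl.2.2.1.1) hs
  linarith

/-- Since `r⁴ = 3 g² r² + c₁ r`, the threshold on `c₀` says exactly that the diagonal quartic is
negative at `r`. -/
theorem exists_quartic_root {g r c₀ c₁ : ℝ}
    (hc₁ : c₁ = r ^ 3 - 3 * g ^ 2 * r) (hc₀ : -3 * g ^ 2 * r ^ 2 - 3 * c₁ * r < c₀) :
    ∃ t, r < t ∧ t ^ 4 - 6 * g ^ 2 * t ^ 2 - 4 * c₁ * t - c₀ = 0 := by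
  have hneg : r ^ 4 - 6 * g ^ 2 * r ^ 2 - 4 * c₁ * r - c₀ < 0 := by
    have : c₁ * r = r ^ 4 - 3 * g ^ 2 * r ^ 2 := by rw [hc₁]; ring
    linarith
  obtain ⟨N, hN⟩ : ∃ N, N = 6 * g ^ 2 + 4 * |c₁| + |c₀| + 1 + |r| := ⟨_, rfl⟩
  have a1 := abs_nonneg c₁
  have a0 := abs_nonneg c₀
  have ar := abs_nonneg r
  have b1 := le_abs_self c₁
  have b0 := le_abs_self c₀
  have br := le_abs_self r
  have hg2 := sq_nonneg g
  have hN1 : 1 ≤ N := by linarith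
  have hcont : ContinuousOn (fun t : ℝ => t ^ 4 - 6 * g ^ 2 * t ^ 2 - 4 * c₁ * t - c₀)
      (Set.Icc r N) := by fun_prop
  obtain ⟨t, ⟨ht1, -⟩, ht⟩ := intermediate_value_Icc (by linarith) hcont
    (show (0 : ℝ) ∈ Set.Icc _ _ from ⟨hneg.le, by
      have h2 : 1 ≤ N ^ 2 := one_le_pow₀ hN1
      have h3 : N ≤ N ^ 2 := by nlinarith
      have h4 : N * N ^ 2 ≤ N ^ 2 * N ^ 2 := mul_le_mul_of_nonneg_right h3 (by positivity)
      have h5 : c₁ * N ≤ |c₁| * N ^ 2 := by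
        calc c₁ * N ≤ |c₁| * N := by gcongr
          _ ≤ _ := by gcongr
      have h6 : |c₀| ≤ |c₀| * N ^ 2 := le_mul_of_one_le_right a0 h2
      have h7 : (6 * g ^ 2 + 4 * |c₁| + |c₀|) * N ^ 2 ≤ N * N ^ 2 :=
        mul_le_mul_of_nonneg_right (by linarith) (by positivity)
      linarith⟩)
  refine ⟨t, lt_of_le_of_ne ht1 ?_, ht⟩
  rintro rfl
  exact hneg.ne ht

/-- Square roots of quadratic polynomials with nonpositive discriminant are convex. -/
theorem sqrt_quadratic_combo_le {α β γ a b x y : ℝ} (ha : 0 ≤ a) (hb : 0 ≤ b) (hab : a + b = 1)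
    (hdisc : β ^ 2 ≤ α * γ) (hx : 0 ≤ α * x ^ 2 + 2 * β * x + γ)
    (hy : 0 ≤ α * y ^ 2 + 2 * β * y + γ) :
    √(α * (a * x + b * y) ^ 2 + 2 * β * (a * x + b * y) + γ) ≤
      a * √(α * x ^ 2 + 2 * β * x + γ) + b * √(α * y ^ 2 + 2 * β * y + γ) := by
  have hR := Real.sqrt_nonneg (α * x ^ 2 + 2 * β * x + γ)
  have hS := Real.sqrt_nonneg (α * y ^ 2 + 2 * β * y + γ)
  have hRR := Real.sq_sqrt hx
  have hSS := Real.sq_sqrt hy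
  set R := √(α * x ^ 2 + 2 * β * x + γ)
  set S := √(α * y ^ 2 + 2 * β * y + γ)
  refine Real.sqrt_le_iff.2 ⟨by positivity, ?_⟩
  have hpol : α * x * y + β * (x + y) + γ ≤ R * S := by
    refine (abs_le_of_sq_le_sq' ?_ (by positivity)).2
    rw [mul_pow, hRR, hSS]
    nlinarith [mul_nonneg (sub_nonneg.2 hdisc) (sq_nonneg (x - y))]
  have hb' : b = 1 - a := by linarith
  have := mul_le_mul_of_nonneg_left hpol (mul_nonneg ha hb)
  have e : α * (a * x + b * y) ^ 2 + 2 * β * (a * x + b * y) + γ =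
      a ^ 2 * (α * x ^ 2 + 2 * β * x + γ) + b ^ 2 * (α * y ^ 2 + 2 * β * y + γ) +
        2 * (a * b * (α * x * y + β * (x + y) + γ)) := by
    subst hb'; ring
  rw [e, ← hRR, ← hSS]
  linarith

theorem quadratic_pos_of_le {g r c₀ c₁ m : ℝ} (hg : 0 ≤ g) (hr : g ≤ r)
    (hc₁ : c₁ = r ^ 3 - 3 * g ^ 2 * r) (hc₀ : -3 * g ^ 2 * r ^ 2 - 3 * c₁ * r < c₀) (hm : r ≤ m) :
    0 < 4 * g ^ 2 * m ^ 2 + 4 * c₁ * m + (c₀ + g ^ 4) := by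
  have hlow : -2 * g ^ 3 ≤ c₁ := hc₁ ▸ neg_two_mul_cube_le hg hr
  have e : 4 * g ^ 2 * m ^ 2 + 4 * c₁ * m + (c₀ + g ^ 4) =
      (r ^ 2 - g ^ 2) ^ 2 + (c₀ - (-3 * g ^ 2 * r ^ 2 - 3 * c₁ * r)) +
        4 * (m - r) * (g ^ 2 * (m + r) + c₁) := by
    rw [hc₁]; ring
  have h1 : 0 ≤ g ^ 2 * (m + r) + c₁ := by
    have : g ^ 2 * (2 * g) ≤ g ^ 2 * (m + r) :=
      mul_le_mul_of_nonneg_left (by linarith) (sq_nonneg g)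
    linarith
  rw [e]
  have := mul_nonneg (sub_nonneg.2 hm) h1
  have := sq_nonneg (r ^ 2 - g ^ 2)
  linarith

theorem invSigma_four_pairs (g c₀ c₁ w z : ℝ) :
    invSigma ![c₀, c₁, g ^ 2, 0] ![w, w, z, z] = (w * z - g ^ 2) ^ 2 -
      (4 * g ^ 2 * ((w + z) / 2) ^ 2 + 4 * c₁ * ((w + z) / 2) + (c₀ + g ^ 4)) := by
  rw [invSigma_four_vec]; ring

/-- Adding the two derivative conditions and using `w z ≤ m²` gives `m³ - 3 g² m > c₁` for the mean
`m`. The second bound is `invSigma_four_pairs` read as a difference of squares. -/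
theorem pairs_bounds {g r c₀ c₁ w z : ℝ} (hg : 0 ≤ g) (hr : g ≤ r)
    (hc₁ : c₁ = r ^ 3 - 3 * g ^ 2 * r) (h : ![w, w, z, z] ∈ quarticRegion g c₁)
    (h0 : 0 < invSigma ![c₀, c₁, g ^ 2, 0] ![w, w, z, z]) :
    r < (w + z) / 2 ∧ √(4 * g ^ 2 * ((w + z) / 2) ^ 2 + 4 * c₁ * ((w + z) / 2) + (c₀ + g ^ 4)) <
      w * z - g ^ 2 := by
  have hw : 0 < w := h.1.1.1
  have hz : 0 < z := h.1.2.1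
  have hwz : g ^ 2 < w * z := h.2.1.2.1.1
  have d1 : g ^ 2 * (w + w + z) + c₁ < w * w * z := h.2.2.1.1
  have d2 : g ^ 2 * (w + z + z) + c₁ < w * z * z := h.2.2.2.1
  rw [invSigma_four_pairs] at h0
  constructor
  · have hs := lt_add_of_sq_lt_mul hw hz hwz
    refine lt_of_cubic_pos hg hr (by linarith) ?_
    rw [← hc₁]
    have : (w + z) * (w * z) ≤ (w + z) * ((w + z) / 2) ^ 2 :=
      mul_le_mul_of_nonneg_left (by nlinarith [sq_nonneg (w - z)]) (by positivity)
    nlinarith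
  · exact (Real.sqrt_lt' (sub_pos.2 hwz)).2 (by linarith)

theorem quartic_pos_iff {g r c₀ c₁ t m : ℝ} (hg : 0 ≤ g) (hr : g ≤ r)
    (hc₁ : c₁ = r ^ 3 - 3 * g ^ 2 * r) (ht : r < t) (hm : r < m)
    (h0 : t ^ 4 - 6 * g ^ 2 * t ^ 2 - 4 * c₁ * t - c₀ = 0) :
    0 < m ^ 4 - 6 * g ^ 2 * m ^ 2 - 4 * c₁ * m - c₀ ↔ t < m := by
  have hval : ∀ m : ℝ, invSigma ![c₀, c₁, g ^ 2, 0] (fun _ => m) =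
      m ^ 4 - 6 * g ^ 2 * m ^ 2 - 4 * c₁ * m - c₀ := by
    intro m; rw [invSigma_four]; ring
  have hmono : ∀ x y : ℝ, r < x → x < y → x ^ 4 - 6 * g ^ 2 * x ^ 2 - 4 * c₁ * x - c₀ <
      y ^ 4 - 6 * g ^ 2 * y ^ 2 - 4 * c₁ * y - c₀ := by
    intro x y hx hxy
    have := invSigma_four_strictMono (c₀ := c₀) (diag_mem_quarticRegion hg hr hc₁ hx)
      (sub_pos.2 hxy)
    simpa only [add_sub_cancel, hval] using this
  constructor
  · intro h
    by_contra hc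
    rcases (not_lt.1 hc).eq_or_lt with rfl | hlt
    · linarith
    · have := hmono m t hm hlt
      linarith
  · intro h
    have := hmono t m ht h
    linarith

/-- Convexity of the plane section `{(w, w, z, z)}` of the region. -/
theorem invSigma_four_pairs_combo_pos {g r c₀ c₁ : ℝ} (hg : 0 ≤ g) (hr : g ≤ r)
    (hc₁ : c₁ = r ^ 3 - 3 * g ^ 2 * r) (hc₀ : -3 * g ^ 2 * r ^ 2 - 3 * c₁ * r < c₀)
    {w₁ z₁ w₂ z₂ a b : ℝ} (h₁ : ![w₁, w₁, z₁, z₁] ∈ quarticRegion g c₁)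
    (h₂ : ![w₂, w₂, z₂, z₂] ∈ quarticRegion g c₁)
    (hf₁ : 0 < invSigma ![c₀, c₁, g ^ 2, 0] ![w₁, w₁, z₁, z₁])
    (hf₂ : 0 < invSigma ![c₀, c₁, g ^ 2, 0] ![w₂, w₂, z₂, z₂])
    (ha : 0 ≤ a) (hb : 0 ≤ b) (hab : a + b = 1) :
    0 < invSigma ![c₀, c₁, g ^ 2, 0] ![a * w₁ + b * w₂, a * w₁ + b * w₂,
      a * z₁ + b * z₂, a * z₁ + b * z₂] := by
  have hlow : -2 * g ^ 3 ≤ c₁ := hc₁ ▸ neg_two_mul_cube_le hg hr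
  obtain ⟨hm₁, hs₁⟩ := pairs_bounds hg hr hc₁ h₁ hf₁
  obtain ⟨hm₂, hs₂⟩ := pairs_bounds hg hr hc₁ h₂ hf₂
  have em : (a * w₁ + b * w₂ + (a * z₁ + b * z₂)) / 2 =
      a * ((w₁ + z₁) / 2) + b * ((w₂ + z₂) / 2) := by ring
  set m₁ := (w₁ + z₁) / 2 with hm₁def
  set m₂ := (w₂ + z₂) / 2 with hm₂def
  have hm : r < a * m₁ + b * m₂ := by
    have := lt_combo ha hb hab hm₁ hm₂
    rwa [← add_mul, hab, one_mul] at this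
  have hQ := fun m (hm : r ≤ m) => quadratic_pos_of_le hg hr hc₁ hc₀ hm
  have suff : √(4 * g ^ 2 * (a * m₁ + b * m₂) ^ 2 + 4 * c₁ * (a * m₁ + b * m₂) + (c₀ + g ^ 4)) <
      (a * w₁ + b * w₂) * (a * z₁ + b * z₂) - g ^ 2 → 0 < invSigma ![c₀, c₁, g ^ 2, 0]
        ![a * w₁ + b * w₂, a * w₁ + b * w₂, a * z₁ + b * z₂, a * z₁ + b * z₂] := by
    intro h
    rw [invSigma_four_pairs, em]
    have := (Real.sqrt_lt' ((Real.sqrt_nonneg _).trans_lt h)).1 h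
    linarith
  -- The sign of the discriminant of `Q` decides whether `√Q` is convex or concave.
  rcases le_total (c₁ ^ 2) (g ^ 2 * (c₀ + g ^ 4)) with hk | hk
  · by_cases hord : (w₁ - w₂) * (z₁ - z₂) ≤ 0
    · apply suff
      have h := sqrt_quadratic_combo_le (α := 4 * g ^ 2) (β := 2 * c₁) (γ := c₀ + g ^ 4) ha hb hab
        (by nlinarith) (x := m₁) (y := m₂) (by have := hQ m₁ hm₁.le; linarith)
        (by have := hQ m₂ hm₂.le; linarith)
      rw [show 2 * (2 * c₁) = 4 * c₁ by ring] at h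
      refine (h.trans_lt (lt_combo ha hb hab hs₁ hs₂)).trans_le ?_
      have hb' : b = 1 - a := by linarith
      have := mul_nonneg (mul_nonneg ha hb) (neg_nonneg.2 hord)
      subst hb'
      nlinarith
    · have hmono : ∀ {w z w' z' : ℝ}, ![w, w, z, z] ∈ quarticRegion g c₁ →
          0 < invSigma ![c₀, c₁, g ^ 2, 0] ![w, w, z, z] → w ≤ w' → z ≤ z' →
          0 < invSigma ![c₀, c₁, g ^ 2, 0] ![w', w', z', z'] := by
        intro w z w' z' h hf hw hz
        have h1 := invSigma_four_lt_of_le (c₀ := c₀) h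
          (s := ![w' - w, w' - w, z' - z, z' - z]) (by
            intro i; fin_cases i <;> simpa)
        have h2 : (fun i => ![w, w, z, z] i + ![w' - w, w' - w, z' - z, z' - z] i) =
            ![w', w', z', z'] := by
          funext i; fin_cases i <;> simp
        have h3 := mul_nonneg (sub_pos.2 h.2.2.1.1).le (sub_nonneg.2 hz)
        rw [h2] at h1
        exact lt_of_lt_of_le (lt_of_lt_of_le hf (le_add_of_nonneg_right h3)) h1
      have hb' : b = 1 - a := by linarith
      rcases le_total w₁ w₂ with hw | hw
      · have hz : z₁ ≤ z₂ := by
          by_contra hz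
          exact hord (mul_nonpos_of_nonpos_of_nonneg (by linarith) (by linarith))
        refine hmono h₁ hf₁ ?_ ?_
        · have := mul_nonneg hb (sub_nonneg.2 hw)
          subst hb'; linarith
        · have := mul_nonneg hb (sub_nonneg.2 hz)
          subst hb'; linarith
      · have hz : z₂ ≤ z₁ := by
          by_contra hz
          exact hord (mul_nonpos_of_nonneg_of_nonpos (by linarith) (by linarith))
        refine hmono h₂ hf₂ ?_ ?_
        · have := mul_nonneg ha (sub_nonneg.2 hw)
          subst hb'; linarith
        · have := mul_nonneg ha (sub_nonneg.2 hz)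
          subst hb'; linarith
  · apply suff
    obtain ⟨t, htr, ht⟩ := exists_quartic_root hc₁ hc₀
    have hUQ : ∀ m : ℝ, (m ^ 2 - g ^ 2) ^ 2 - (4 * g ^ 2 * m ^ 2 + 4 * c₁ * m + (c₀ + g ^ 4)) =
        m ^ 4 - 6 * g ^ 2 * m ^ 2 - 4 * c₁ * m - c₀ := by intro m; ring
    have hU : ∀ m : ℝ, r < m → 0 < m ^ 2 - g ^ 2 := by intro m hm; nlinarith
    have hT : ∀ m, r < m → (t < m ↔ 0 < m ^ 2 - g ^ 2 -
        √(4 * g ^ 2 * m ^ 2 + 4 * c₁ * m + (c₀ + g ^ 4))) := by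
      intro m hm
      rw [← quartic_pos_iff hg hr hc₁ htr hm ht, ← hUQ m, sub_pos, sub_pos, Real.sqrt_lt' (hU m hm)]
    have hconc := sqrt_sub_sqrt_concaveOn (c₂ := g ^ 2) (c₁ := c₁) (k := c₀ + g ^ 4) (t := t)
      (by linarith) (fun m hm => hQ m (htr.le.trans hm))
      (fun m hm => by
        have : g ^ 2 * g ≤ g ^ 2 * m := mul_le_mul_of_nonneg_left (by linarith) (sq_nonneg g)
        linarith)
      (by
        rw [← Real.sqrt_sq (hU t htr).le]
        congr 1
        have := hUQ t
        linarith)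
      (fun m hm => (hT m (htr.trans hm)).1 hm)
    have hd : ∀ w z : ℝ, w * z = ((w + z) / 2) ^ 2 - ((w - z) / 2) ^ 2 := by intro w z; ring
    have hT₁ : ((w₁ - z₁) / 2) ^ 2 < m₁ ^ 2 - g ^ 2 -
        √(4 * g ^ 2 * m₁ ^ 2 + 4 * c₁ * m₁ + (c₀ + g ^ 4)) := by
      rw [hd w₁ z₁, ← hm₁def] at hs₁; linarith
    have hT₂ : ((w₂ - z₂) / 2) ^ 2 < m₂ ^ 2 - g ^ 2 -
        √(4 * g ^ 2 * m₂ ^ 2 + 4 * c₁ * m₂ + (c₀ + g ^ 4)) := by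
      rw [hd w₂ z₂, ← hm₂def] at hs₂; linarith
    have ht₁ : t < m₁ := (hT m₁ hm₁).2 ((sq_nonneg _).trans_lt hT₁)
    have ht₂ : t < m₂ := (hT m₂ hm₂).2 ((sq_nonneg _).trans_lt hT₂)
    have hcombo := hconc.2 ht₁ ht₂ ha hb hab
    simp only [smul_eq_mul] at hcombo
    have hd₁ := Real.lt_sqrt_of_sq_lt (x := |(w₁ - z₁) / 2|) (by rwa [sq_abs])
    have hd₂ := Real.lt_sqrt_of_sq_lt (x := |(w₂ - z₂) / 2|) (by rwa [sq_abs])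
    have hlt := (lt_combo ha hb hab hd₁ hd₂).trans_le hcombo
    have habs : |a * ((w₁ - z₁) / 2) + b * ((w₂ - z₂) / 2)| ≤
        a * |(w₁ - z₁) / 2| + b * |(w₂ - z₂) / 2| := by
      refine (abs_add_le _ _).trans (le_of_eq ?_)
      rw [abs_mul, abs_mul, abs_of_nonneg ha, abs_of_nonneg hb]
    have hfin := (Real.lt_sqrt (abs_nonneg _)).1 (habs.trans_lt hlt)
    rw [sq_abs] at hfin
    rw [hd (a * w₁ + b * w₂) (a * z₁ + b * z₂), em]
    have e : (a * w₁ + b * w₂ - (a * z₁ + b * z₂)) / 2 =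
        a * ((w₁ - z₁) / 2) + b * ((w₂ - z₂) / 2) := by ring
    rw [e]
    linarith

theorem hasConvexLevelSet_four {g r c₀ c₁ : ℝ} (hg : 0 ≤ g) (hr : g ≤ r)
    (hc₁ : c₁ = r ^ 3 - 3 * g ^ 2 * r) (hc₀ : -3 * g ^ 2 * r ^ 2 - 3 * c₁ * r < c₀) :
    HasConvexLevelSet (invSigma ![c₀, c₁, g ^ 2, 0]) := by
  have hlow : -2 * g ^ 3 ≤ c₁ := hc₁ ▸ neg_two_mul_cube_le hg hr
  have hf : Continuous (invSigma ![c₀, c₁, g ^ 2, 0]) := by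
    rw [funext (invSigma_four c₀ c₁ (g ^ 2))]; fun_prop
  refine hasConvexLevelSet_of_region (P := quarticRegion g c₁) hf
    (fun i j hij l => exists_pairForm_four c₀ c₁ (g ^ 2) i j hij l) (isOpen_quarticRegion g c₁)
    (fun l hl h0 => mem_quarticRegion_of_mem_closure hg hr hc₁ hc₀ hl h0) ?_
    (fun L hL => levelSet_subset_quarticRegion hL)
    (fun l hl s hs => invSigma_four_strictMono hl hs) ?_ ?_
  · rintro l ⟨⟨⟨h0, h1⟩, h2, h3⟩, -⟩ i
    fin_cases i
    exacts [h0, h1, h2, h3]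
  · obtain ⟨t, htr, ht⟩ := exists_quartic_root hc₁ hc₀
    refine ⟨t, diag_mem_quarticRegion hg hr hc₁ htr, ?_⟩
    rw [invSigma_four]
    linarith
  · rintro l ⟨hl, hl0⟩ k ⟨hk, hk0⟩ a b ha hb hab
    refine ⟨convex_quarticRegion hg hlow hl hk ha hb hab, ?_⟩
    -- Both endpoints are moved to vertices in the last two coordinates, then, after the swap, in
    -- the first two; positivity of the combination is carried back in reverse order.
    obtain ⟨l1, fl1⟩ := vertex_mem_quarticRegion hg hr hc₁ hc₀ hl hl0
    obtain ⟨k1, fk1⟩ := vertex_mem_quarticRegion hg hr hc₁ hc₀ hk hk0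
    have l2 := quarticRegion_swap l1
    have k2 := quarticRegion_swap k1
    rw [invSigma_four_swap] at fl1 fk1
    obtain ⟨l3, fl3⟩ := vertex_mem_quarticRegion hg hr hc₁ hc₀ l2 fl1
    obtain ⟨k3, fk3⟩ := vertex_mem_quarticRegion hg hr hc₁ hc₀ k2 fk1
    have h1 := invSigma_four_pairs_combo_pos hg hr hc₁ hc₀ l3 k3 fl3 fk3 ha hb hab
    have h2 := invSigma_four_combo_pos hg hlow l2 k2 ha hb hab h1
    have h3 := invSigma_four_combo_pos (c₀ := c₀) hg hlow hl hk ha hb hab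
      (by rw [invSigma_four_swap]; exact h2)
    have e : a • l + b • k = ![a * l 0 + b * k 0, a * l 1 + b * k 1,
        a * l 2 + b * k 2, a * l 3 + b * k 3] := by
      funext i; fin_cases i <;> simp
    change 0 < invSigma _ (a • l + b • k)
    rw [e]
    exact h3

end QuarticLevelSet

/-! ### The closed formula for the largest root of the cubic. -/

section CubicRoot

theorem sq_rpow_three_halves {g : ℝ} (hg : 0 ≤ g) : (g ^ 2) ^ (3 / 2 : ℝ) = g ^ 3 := by
  rw [← Real.rpow_natCast g 2, ← Real.rpow_mul hg, ← Real.rpow_natCast g 3]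
  norm_num

/-- For `g > 0`, substituting `2 g C` turns the cubic equation into the triple angle formula for
`cos` or `cosh`. The bound `g ≤ x` singles out the largest root, as `x³ - 3 g² x` is strictly
increasing from `g` on. -/
theorem cubicRoot_spec {g c₁ : ℝ} (hg : 0 ≤ g) (hc₁ : -2 * g ^ 3 ≤ c₁) :
    g ≤ cubicRoot c₁ (g ^ 2) ∧
      c₁ = cubicRoot c₁ (g ^ 2) ^ 3 - 3 * g ^ 2 * cubicRoot c₁ (g ^ 2) := by
  unfold cubicRoot
  rw [sq_rpow_three_halves hg, Real.sqrt_sq hg]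
  split_ifs with h0 h1
  · have hg0 : g = 0 := pow_eq_zero_iff two_ne_zero |>.1 h0
    subst hg0
    have hc : 0 ≤ c₁ := by simpa using hc₁
    refine ⟨Real.rpow_nonneg hc _, ?_⟩
    rw [← Real.rpow_natCast (c₁ ^ (1 / 3 : ℝ)) 3, ← Real.rpow_mul hc]
    norm_num
  · have hg0 : 0 < g := lt_of_le_of_ne hg fun h => h0 (by rw [← h]; norm_num)
    have hg3 : 0 < 2 * g ^ 3 := by positivity
    have habs := abs_le_of_sq_le_sq' (show c₁ ^ 2 ≤ (2 * g ^ 3) ^ 2 by linarith) hg3.le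
    have hcos : Real.cos (3 * (1 / 3 * Real.arccos (c₁ / (2 * g ^ 3)))) = c₁ / (2 * g ^ 3) := by
      rw [show 3 * (1 / 3 * Real.arccos (c₁ / (2 * g ^ 3))) = Real.arccos (c₁ / (2 * g ^ 3)) by ring]
      refine Real.cos_arccos ?_ ?_
      · rw [le_div_iff₀ hg3]; linarith
      · rw [div_le_iff₀ hg3]; linarith
    rw [Real.cos_three_mul, eq_div_iff hg3.ne'] at hcos
    -- A third of an `arccos` lies in `[0, π / 3]`, so the root is at least `g`.
    have hhalf : 1 / 2 ≤ Real.cos (1 / 3 * Real.arccos (c₁ / (2 * g ^ 3))) := by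
      rw [← Real.cos_pi_div_three]
      have h1 := Real.arccos_le_pi (c₁ / (2 * g ^ 3))
      have h2 := Real.arccos_nonneg (c₁ / (2 * g ^ 3))
      exact Real.cos_le_cos_of_nonneg_of_le_pi (by linarith) (by linarith [Real.pi_pos])
        (by linarith)
    generalize Real.cos (1 / 3 * Real.arccos (c₁ / (2 * g ^ 3))) = C at hcos hhalf
    refine ⟨by nlinarith, ?_⟩
    rw [← hcos]; ring
  · have hg0 : 0 < g := lt_of_le_of_ne hg fun h => h0 (by rw [← h]; norm_num)
    have hg3 : 0 < 2 * g ^ 3 := by positivity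
    have hc : 2 * g ^ 3 < c₁ := by
      by_contra hc
      apply h1
      nlinarith [mul_nonneg (sub_nonneg.2 (not_lt.1 hc)) (sub_nonneg.2 hc₁)]
    have hcosh : Real.cosh (3 * (1 / 3 * Real.arcosh (c₁ / (2 * g ^ 3)))) = c₁ / (2 * g ^ 3) := by
      rw [show 3 * (1 / 3 * Real.arcosh (c₁ / (2 * g ^ 3))) = Real.arcosh (c₁ / (2 * g ^ 3)) by ring]
      refine Real.cosh_arcosh ?_
      rw [le_div_iff₀ hg3]; linarith
    rw [Real.cosh_three_mul, eq_div_iff hg3.ne'] at hcosh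
    have hone := Real.one_le_cosh (1 / 3 * Real.arcosh (c₁ / (2 * g ^ 3)))
    generalize Real.cosh (1 / 3 * Real.arcosh (c₁ / (2 * g ^ 3))) = C at hcosh hone
    refine ⟨by nlinarith, ?_⟩
    rw [← hcosh]; ring

end CubicRoot

theorem proposition4p1 :
    -- degree two: `l₁ l₂ - c₀ = 0`
    (∀ c₀ : ℝ, 0 < c₀ → HasConvexLevelSet (invSigma ![c₀, 0])) ∧
    -- degree three: `l₁ l₂ l₃ - c₁ σ₁(l) - c₀ = 0`
    (∀ c₀ c₁ : ℝ, 0 ≤ c₁ → -2 * c₁ ^ (3 / 2 : ℝ) < c₀ →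
      HasConvexLevelSet (invSigma ![c₀, c₁, 0])) ∧
    -- degree four: `l₁ l₂ l₃ l₄ - c₂ σ₂(l) - c₁ σ₁(l) - c₀ = 0`
    (∀ c₁ c₂ : ℝ, 0 ≤ c₂ → -2 * c₂ ^ (3 / 2 : ℝ) ≤ c₁ →
      IsGreatest {x : ℝ | x ^ 3 - 3 * c₂ * x - c₁ = 0} (cubicRoot c₁ c₂) ∧
      ∀ c₀ : ℝ, -3 * c₂ * cubicRoot c₁ c₂ ^ 2 - 3 * c₁ * cubicRoot c₁ c₂ < c₀ →
        HasConvexLevelSet (invSigma ![c₀, c₁, c₂, 0])) := by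
  refine ⟨fun c₀ h => hasConvexLevelSet_two h, fun c₀ c₁ hc₁ h => ?_, fun c₁ c₂ hc₂ h => ?_⟩
  · obtain ⟨g, hg, rfl⟩ : ∃ g, 0 ≤ g ∧ g ^ 2 = c₁ := ⟨√c₁, Real.sqrt_nonneg _, Real.sq_sqrt hc₁⟩
    rw [sq_rpow_three_halves hg] at h
    exact hasConvexLevelSet_three hg h
  · obtain ⟨g, hg, rfl⟩ : ∃ g, 0 ≤ g ∧ g ^ 2 = c₂ := ⟨√c₂, Real.sqrt_nonneg _, Real.sq_sqrt hc₂⟩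
    rw [sq_rpow_three_halves hg] at h
    obtain ⟨hr, hroot⟩ := cubicRoot_spec hg h
    refine ⟨⟨sub_eq_zero.2 hroot.symm, fun y hy => ?_⟩, fun c₀ h₀ =>
      hasConvexLevelSet_four hg hr hroot h₀⟩
    by_contra hlt
    have h1 := cubic_lt_of_lt hg hr (not_le.1 hlt)
    have h2 : y ^ 3 - 3 * g ^ 2 * y - c₁ = 0 := hy
    linarith
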